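/- Let $k$ be a field, $d\ge 2$, and let $\mathcal T$ be a $k$-linear, Hom-finite, idempotent-complete $d$-Calabi--Yau triangulated category, i.e. there are functorial isomorphisms $\mathcal T(A,B)\simeq D\mathcal T(B,A[d])$ with $D=\operatorname{Hom}_k(-,k)$. Let $T\in\mathcal T$ be $d$-cluster tilting, i.e. $\operatorname{add}T=\{A\mid \mathcal T(T,A[i])=0 \text{ for } 0<i<d\}=\{A\mid \mathcal T(A,T[i])=0\text{ for }0<i<d\}$. Put $X=T\oplus T[-1]\oplus\cdots\oplus T[-(d-2)]$ and assume that $H=\operatorname{End}_{\mathcal T}(X)$ is hereditary. Let $\operatorname{mod}H$ be the category of finitely generated right $H$-modules, let $\underline{\operatorname{mod}}\,H$ (resp. $\overline{\operatorname{mod}}\,H$) be its quotient by the ideal of morphisms that factor through a projective (resp. injective) object, let $\tau=D\operatorname{Ext}^1_H(-,H)$ be the Auslander--Reiten translation, and let $F=\mathcal T(X,-)\colon\mathcal T\to\operatorname{mod}H$. For an object $M$ write $\mathcal T/[M]$ for the quotient of $\mathcal T$ by the ideal of morphisms that factor through an object of $\operatorname{add}M$. (1) The functor $F$ induces equivalences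 $\underline F\colon\mathcal T/[X\oplus T[1]]\to\underline{\operatorname{mod}}\,H$ and $\overline F\colon\mathcal T/[T[1]\oplus X[d]]\to\overline{\operatorname{mod}}\,H$. (2) On the full subcategory of $\mathcal T$ formed by the objects that have no nonzero direct summand in $\operatorname{add}(X\oplus T[1])$ there is an isomorphism $F\circ[d-1]\simeq\tau\circ F$ of functors to $\operatorname{mod}H$. Moreover $[d-1]$ and $\tau$ induce equivalences $\mathcal T/[X\oplus T[1]]\to\mathcal T/[T[1]\oplus X[d]]$ and $\underline{\operatorname{mod}}\,H\to\overline{\operatorname{mod}}\,H$, and with these there is an isomorphism $\overline F\circ[d-1]\simeq\tau\circ\underline F$ of functors $\mathcal T/[X\oplus T[1]]\to\overline{\operatorname{mod}}\,H$. (3) Consequently $\operatorname{ind}\mathcal T=\operatorname{ind}(\operatorname{mod}H)\sqcup\operatorname{ind}(\operatorname{add}T[1])$, where $\operatorname{ind}$ denotes the set of isomorphism classes of indecomposable objects: $F$ induces a bijection from $\operatorname{ind}\mathcal T\setminus\operatorname{ind}(\operatorname{add}T[1])$ onto $\operatorname{ind}(\operatorname{mod}H)$. -/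

import Mathlib

open CategoryTheory CategoryTheory.Limits

universe v u

namespace ClusterHereditary

noncomputable section

/-! ### Categories: ideal quotients, additive closures, indecomposables -/

section General

variable {C : Type*} [Category C] [Preadditive C]

/-- Two parallel morphisms are related when their difference factors through an object
satisfying `P`. -/
def idealRel (P : ObjectProperty C) : HomRel C := fun A B f g =>
  ∃ (Z : C) (_ : P Z) (a : A ⟶ Z) (b : Z ⟶ B), a ≫ b = f - g

/-- The ideal quotient `C / [P]`: same objects, morphisms modulo those factoring through `P`. -/
abbrev IdealQuotient (P : ObjectProperty C) := CategoryTheory.Quotient (idealRel P)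

/-- The projection functor `C ⥤ C / [P]`. -/
abbrev idealProj (P : ObjectProperty C) : C ⥤ IdealQuotient P :=
  CategoryTheory.Quotient.functor (idealRel P)

/-- `G : C / [P] ⥤ D / [Q]` is the functor induced by `F : C ⥤ D` on ideal quotients
(it is uniquely determined by this equation). -/
def IsInducedBy {D : Type*} [Category D] [Preadditive D] {P : ObjectProperty C}
    {Q : ObjectProperty D} (F : C ⥤ D) (G : IdealQuotient P ⥤ IdealQuotient Q) : Prop :=
  idealProj P ⋙ G = F ⋙ idealProj Q

/-- `add X`: the direct summands of finite direct sums of copies of `X`. -/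
def addClosure [HasFiniteBiproducts C] (X : C) : ObjectProperty C := fun A =>
  ∃ n : ℕ, Nonempty (Retract A (⨁ fun _ : Fin n => X))

/-- Objects all of whose direct summands satisfying `P` are zero. -/
def noSummandIn (P : ObjectProperty C) : ObjectProperty C := fun A =>
  ∀ B : C, P B → Nonempty (Retract B A) → IsZero B

/-- A nonzero object is indecomposable if in each decomposition `A ≅ Y ⊕ Z` one of the two
summands is zero (`b` is a direct sum diagram on `Y` and `Z` with vertex `b.pt`). -/
def IsIndecomposable (A : C) : Prop :=
  ¬ IsZero A ∧ ∀ (Y Z : C) (b : BinaryBicone Y Z), b.IsBilimit → Nonempty (A ≅ b.pt) →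
    IsZero Y ∨ IsZero Z

end General

/-- The isomorphism classes of objects of `C`. -/
abbrev IsoClasses (C : Type*) [Category C] := _root_.Quotient (isIsomorphicSetoid C)

/-- The map induced by a functor on isomorphism classes. -/
def mapIsoClasses {C D : Type*} [Category C] [Category D] (F : C ⥤ D) :
    IsoClasses C → IsoClasses D :=
  _root_.Quotient.map F.obj fun _ _ ⟨e⟩ => ⟨F.mapIso e⟩

/-- The isomorphism classes of the indecomposable objects of `C` that satisfy `P`. -/
def indIn {C : Type*} [Category C] [Preadditive C] (P : ObjectProperty C) :
    Set (IsoClasses C) :=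
  {c | ∃ A : C, IsIndecomposable A ∧ P A ∧ c = _root_.Quotient.mk _ A}

/-- `ind C`: the isomorphism classes of the indecomposable objects of `C`. -/
def ind (C : Type*) [Category C] [Preadditive C] : Set (IsoClasses C) := indIn (C := C) ⊤

/-! ### Finite dimensional algebras -/

/-- A ring is hereditary if all its left ideals and all its right ideals are projective. -/
def IsHereditary (R : Type*) [Ring R] : Prop :=
  (∀ I : Submodule R R, Module.Projective R I) ∧
    ∀ I : Submodule Rᵐᵒᵖ R, Module.Projective Rᵐᵒᵖ I

/-- The stable category of finitely generated left `Λ`-modules: morphisms modulo those that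
factor through a projective object. -/
abbrev StableMod (Λ : Type v) [Ring Λ] :=
  IdealQuotient (C := FGModuleCat.{v} Λ) (fun M => Projective M)

/-- The injectively stable category of finitely generated left `Λ`-modules: morphisms modulo
those that factor through an injective object. -/
abbrev InjStableMod (Λ : Type v) [Ring Λ] :=
  IdealQuotient (C := FGModuleCat.{v} Λ) (fun M => Injective M)

section Translate

open Abelian

variable (k : Type v) [Field k] (Λ : Type v) [Ring Λ] [Algebra k Λ]

/-- Right multiplication by `a`, as an endomorphism of the left module `Λ`. -/
def rightMul (a : Λ) : ModuleCat.of Λ Λ ⟶ ModuleCat.of Λ Λ :=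
  ModuleCat.ofHom (LinearMap.toSpanSingleton Λ Λ a)

variable {Λ} in
/-- `Ext¹_Λ(M, Λ)`. -/
abbrev ExtOne (M : ModuleCat.{v} Λ) : Type v := Ext M (ModuleCat.of Λ Λ) 1

variable {Λ} in
/-- The right action of `a : Λ` on `Ext¹_Λ(M, Λ)` coming from the bimodule structure of `Λ`. -/
def extRightMul (M : ModuleCat.{v} Λ) (a : Λ) : ExtOne M →ₗ[k] ExtOne M :=
  Ext.postcompOfLinear (Ext.mk₀ (rightMul Λ a)) k M (add_zero 1)

variable {Λ} in
/-- `D Ext¹_Λ(M, Λ)`, where `D = Hom_k(-, k)`. -/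
def DExtOne (M : ModuleCat.{v} Λ) : Type v := Module.Dual k (ExtOne M)

variable {Λ}

instance (M : ModuleCat.{v} Λ) : AddCommGroup (DExtOne k M) :=
  inferInstanceAs (AddCommGroup (Module.Dual k (ExtOne M)))

instance (M : ModuleCat.{v} Λ) : Module k (DExtOne k M) :=
  inferInstanceAs (Module k (Module.Dual k (ExtOne M)))

variable {k} in
/-- An element of `DExtOne k M` as a linear form. -/
def DExtOne.form {M : ModuleCat.{v} Λ} (φ : DExtOne k M) : Module.Dual k (ExtOne M) := φ

lemma rightMul_one : rightMul Λ 1 = 𝟙 _ := by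
  ext; simp [rightMul]

lemma rightMul_mul (a b : Λ) : rightMul Λ (a * b) = rightMul Λ a ≫ rightMul Λ b := by
  ext; simp [rightMul]

lemma rightMul_add (a b : Λ) : rightMul Λ (a + b) = rightMul Λ a + rightMul Λ b := by
  ext; simp [rightMul]

lemma extRightMul_apply (M : ModuleCat.{v} Λ) (a : Λ) (x : ExtOne M) :
    extRightMul k M a x = x.comp (Ext.mk₀ (rightMul Λ a)) (add_zero 1) := rfl

lemma extRightMul_one (M : ModuleCat.{v} Λ) : extRightMul k M 1 = LinearMap.id := by
  ext x; simp [extRightMul_apply, rightMul_one]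

lemma extRightMul_mul (M : ModuleCat.{v} Λ) (a b : Λ) :
    extRightMul k M (a * b) = extRightMul k M b ∘ₗ extRightMul k M a := by
  ext x; simp [extRightMul_apply, rightMul_mul]

lemma extRightMul_add (M : ModuleCat.{v} Λ) (a b : Λ) :
    extRightMul k M (a + b) = extRightMul k M a + extRightMul k M b := by
  ext x
  simp [extRightMul_apply, rightMul_add, Ext.mk₀_add]

lemma extRightMul_zero (M : ModuleCat.{v} Λ) : extRightMul k M (0 : Λ) = 0 := by
  have h := extRightMul_add k M (0 : Λ) 0
  rw [add_zero] at h
  exact left_eq_add.mp h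

lemma rightMul_algebraMap (c : k) :
    rightMul Λ (algebraMap k Λ c) =
      (Linear.homModule (R := k) _ _).toSMul.smul c (𝟙 (ModuleCat.of Λ Λ)) := by
  refine ModuleCat.hom_ext (LinearMap.ext fun x => ?_)
  change x * algebraMap k Λ c = algebraMap k Λ c * x
  exact (Algebra.commutes c x).symm

lemma extRightMul_algebraMap (M : ModuleCat.{v} Λ) (c : k) (x : ExtOne M) :
    extRightMul k M (algebraMap k Λ c) x = c • x := by
  rw [extRightMul_apply, rightMul_algebraMap]
  exact (Ext.smul_eq_comp_mk₀ x c).symm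

/-- The left `Λ`-module structure on `D Ext¹_Λ(M, Λ)`: `(a • φ)(x) = φ(x · a)`. -/
instance (M : ModuleCat.{v} Λ) : Module Λ (DExtOne k M) where
  smul a φ := LinearMap.comp (DExtOne.form φ) (extRightMul k M a)
  one_smul φ := LinearMap.ext fun x => congrArg (DExtOne.form φ)
    (DFunLike.congr_fun (extRightMul_one k M) x)
  mul_smul a b φ := LinearMap.ext fun x => congrArg (DExtOne.form φ)
    (DFunLike.congr_fun (extRightMul_mul k M a b) x)
  smul_zero _ := LinearMap.zero_comp _
  smul_add _ _ _ := LinearMap.add_comp _ _ _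
  add_smul a b φ := LinearMap.ext fun x =>
    (congrArg (DExtOne.form φ)
      (DFunLike.congr_fun (extRightMul_add k M a b) x)).trans
        (map_add (DExtOne.form φ) _ _)
  zero_smul φ := LinearMap.ext fun x =>
    (congrArg (DExtOne.form φ)
      (DFunLike.congr_fun (extRightMul_zero k M) x)).trans
        (map_zero (DExtOne.form φ))

instance (M : ModuleCat.{v} Λ) : IsScalarTower k Λ (DExtOne k M) where
  smul_assoc c a φ := LinearMap.ext fun x => by
    change (DExtOne.form φ) (extRightMul k M (c • a) x) =
      c • (DExtOne.form φ) (extRightMul k M a x)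
    rw [Algebra.smul_def, extRightMul_mul, LinearMap.comp_apply, ← map_smul, ← map_smul,
      extRightMul_algebraMap]

/-- The map `D Ext¹_Λ(M, Λ) → D Ext¹_Λ(N, Λ)` induced by `f : M ⟶ N`. -/
def dExtOneMap {M N : ModuleCat.{v} Λ} (f : M ⟶ N) : DExtOne k M →ₗ[Λ] DExtOne k N where
  toFun φ := LinearMap.comp (DExtOne.form φ)
    (Ext.precompOfLinear (Ext.mk₀ f) k (ModuleCat.of Λ Λ) (zero_add 1))
  map_add' _ _ := LinearMap.add_comp _ _ _
  map_smul' a φ := LinearMap.ext fun x => congrArg (DExtOne.form φ)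
    (Ext.comp_assoc (Ext.mk₀ f) x (Ext.mk₀ (rightMul Λ a)) (zero_add 1) (add_zero 1)
      (add_zero (0 + 1)))

lemma dExtOneMap_apply {M N : ModuleCat.{v} Λ} (f : M ⟶ N) (φ : DExtOne k M) (x : ExtOne N) :
    (dExtOneMap k f φ).form x =
      φ.form ((Ext.mk₀ f).comp x (zero_add 1)) := rfl

lemma extOne_finite [Module.Finite k Λ] (M : ModuleCat.{v} Λ) [Module.Finite Λ M] :
    Module.Finite k (ExtOne M) := by
  obtain ⟨n, f, hf⟩ := Module.Finite.exists_fin' Λ M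
  have hS := LinearMap.shortExact_shortComplexKer hf
  let K := ModuleCat.of Λ (LinearMap.ker f)
  have _ : IsNoetherian k (Fin n → Λ) := inferInstance
  have _ : Module.Finite k (LinearMap.ker f) :=
    Module.Finite.of_injective (((LinearMap.ker f).subtype).restrictScalars k)
      (LinearMap.ker f).injective_subtype
  let _ : Module k (K ⟶ ModuleCat.of Λ Λ) := Linear.homModule K (ModuleCat.of Λ Λ)
  let j : (K ⟶ ModuleCat.of Λ Λ) →ₗ[k] (LinearMap.ker f →ₗ[k] Λ) :=
    { toFun := fun g => g.hom.restrictScalars k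
      map_add' := fun _ _ => rfl
      map_smul' := fun c g => LinearMap.ext fun x => by
        change algebraMap k Λ c * g.hom x = c • g.hom x
        rw [Algebra.smul_def] }
  have hj : Function.Injective j := fun g g' h => ModuleCat.hom_ext
    (LinearMap.ext fun x => DFunLike.congr_fun h x)
  have _ : Module.Finite k (K ⟶ ModuleCat.of Λ Λ) := Module.Finite.of_injective j hj
  have _ : Module.Finite k (Ext K (ModuleCat.of Λ Λ) 0) :=
    Module.Finite.equiv (Ext.linearEquiv₀ (R := k)).symm
  refine Module.Finite.of_surjective
    (Ext.precompOfLinear hS.extClass k (ModuleCat.of Λ Λ) (add_zero 1)) fun x => ?_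
  have _ : Projective (ModuleCat.of Λ (Fin n → Λ)) := inferInstance
  exact Ext.contravariant_sequence_exact₃ hS _ x (Ext.eq_zero_of_projective _) (add_zero 1)

instance [Module.Finite k Λ] (M : FGModuleCat.{v} Λ) : Module.Finite Λ (DExtOne k M.obj) := by
  have := extOne_finite k M.obj
  have : Module.Finite k (DExtOne k M.obj) :=
    inferInstanceAs (Module.Finite k (Module.Dual k (ExtOne M.obj)))
  exact Module.Finite.of_restrictScalars_finite k Λ _

variable (Λ)

/-- The Auslander-Reiten translation `τ = D Ext¹_Λ(-, Λ)` of a finite dimensional hereditary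
`k`-algebra `Λ`, on finitely generated left `Λ`-modules. -/
def arTranslate [Module.Finite k Λ] : FGModuleCat.{v} Λ ⥤ FGModuleCat.{v} Λ where
  obj M := FGModuleCat.of Λ (DExtOne k M.obj)
  map f := FGModuleCat.ofHom (dExtOneMap k f.hom)
  map_id M := by
    refine FGModuleCat.hom_ext (LinearMap.ext fun φ => LinearMap.ext fun x => ?_)
    exact congrArg (DExtOne.form φ) (Ext.mk₀_id_comp x)
  map_comp {L M N} f g := by
    refine FGModuleCat.hom_ext (LinearMap.ext fun φ => LinearMap.ext fun x => ?_)
    refine congrArg (DExtOne.form φ) ?_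
    exact (Ext.mk₀_comp_mk₀_assoc f.hom g.hom x).symm

end Translate

/-! ### Hom-finite linear categories -/

section HomFinite

variable (k : Type v) [Field k] (C : Type u) [Category.{v} C] [Preadditive C] [Linear k C]

/-- All morphism spaces are finite dimensional over `k`. -/
class HomFinite : Prop where
  finite_hom : ∀ A B : C, Module.Finite k (A ⟶ B)

variable {C}

instance [HomFinite k C] (X : C) : Module.Finite k (End X)ᵐᵒᵖ :=
  have : Module.Finite k (End X) := HomFinite.finite_hom X X
  Module.Finite.equiv (MulOpposite.opLinearEquiv k)

instance (X A : C) : IsScalarTower k (End X)ᵐᵒᵖ (X ⟶ A) where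
  smul_assoc c e f := Linear.smul_comp X X A c e.unop f

lemma finite_hom_over_end [HomFinite k C] (X A : C) : Module.Finite (End X)ᵐᵒᵖ (X ⟶ A) :=
  have : Module.Finite k (X ⟶ A) := HomFinite.finite_hom X A
  Module.Finite.of_restrictScalars_finite k _ _

/-- The functor `F = Hom(X, -)` to finitely generated right modules over `End X` (which are
left modules over the opposite ring): `End X` acts on `Hom(X, A)` by precomposition. -/
def homFunctor [HomFinite k C] (X : C) : C ⥤ FGModuleCat.{v} (End X)ᵐᵒᵖ :=
  (ModuleCat.isFG _).lift (preadditiveCoyonedaObj X) fun A => finite_hom_over_end k X A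

end HomFinite

/-! ### Calabi-Yau categories and cluster tilting objects -/

section Triangulated

variable (k : Type v) [Field k] (C : Type u) [Category.{v} C] [Preadditive C] [Linear k C]
  [HasShift C ℤ]

/-- The Hom-finite category `C` is `d`-Calabi-Yau: there are isomorphisms
`Hom(A, B) ≅ D Hom(B, A[d])` of `k`-vector spaces which are functorial in `A` and `B`. -/
structure IsCalabiYau [HomFinite k C] (d : ℤ) : Prop where
  exists_duality : ∃ φ : ∀ A B : C, (A ⟶ B) ≃ₗ[k] Module.Dual k (B ⟶ A⟦d⟧),
    ∀ (A A' B B' : C) (a : A' ⟶ A) (f : A ⟶ B) (b : B ⟶ B') (g : B' ⟶ A'⟦d⟧),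
      φ A' B' (a ≫ f ≫ b) g = φ A B f (b ≫ g ≫ a⟦d⟧')

variable {C} [HasFiniteBiproducts C]

/-- `T` is `d`-cluster tilting: `add T` consists exactly of the objects `A` with
`Hom(T, A[i]) = 0` for all `0 < i < d`, and exactly of the objects `A` with
`Hom(A, T[i]) = 0` for all `0 < i < d`. (The approximations that are part of the definition for
general subcategories exist for `add T` as soon as `C` is Hom-finite.) -/
structure IsClusterTilting (d : ℤ) (T : C) : Prop where
  add_iff_right : ∀ A : C, addClosure T A ↔
    ∀ i : ℤ, 0 < i → i < d → ∀ f : T ⟶ A⟦i⟧, f = 0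
  add_iff_left : ∀ A : C, addClosure T A ↔
    ∀ i : ℤ, 0 < i → i < d → ∀ f : A ⟶ T⟦i⟧, f = 0

/-- `T ⊕ T[-1] ⊕ ⋯ ⊕ T[-(d-2)]`, for `d ≥ 2`. -/
def shiftedSum (d : ℕ) (T : C) : C := ⨁ fun i : Fin (d - 1) => T⟦-((i : ℕ) : ℤ)⟧

end Triangulated

end

end ClusterHereditary

open ClusterHereditary

/-!
The proof rests on triangles of `add X`-approximations. Write `F = Hom(X, -)`, let `Λ` be the
opposite of `End X`, so that right modules over `End X` are left `Λ`-modules, and write `add [a, b]`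
(`shiftAdd T a b`) for the summands of sums of the shifts `T[j]` with `a ≤ j ≤ b`. Then `add X` is
`add [2-d, 0]`, `add (X ⊞ T[1])` is `add [2-d, 1]`, and `add (T[1] ⊞ X[d])` is `add [1, d]`.

*Fullness and density.* Let `K ⟶ Z ⟶ A ⟶ K[1]` be the triangle of a right `add X`-approximation of
`A`. Then `F K[1]` is a submodule of `F Z[1]`, which is projective. Since `Λ` is hereditary,
`F K[1]` is projective, and an object with projective image lies in `add [2-d, 1]`
(`IsTiltingPair.shiftAdd_of_projective`). So `K` lies in `add [1-d, 0]`, and `F` detects whether a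
composite `K ⟶ Z ⟶ B` vanishes, as `Hom(T[1-d], X) = 0`. It follows that `F` is full and that the
morphisms killed by `F` factor through `K[1]`. For density, lift a projective resolution of a
module to a morphism `X₁ ⟶ X₀` of `add X` and split off its cone `E` the summand that comes from
the image of `F E` in `F X₁[1]`, which is projective.

*Injectives.* By the Calabi-Yau duality `F X[d]` is an injective cogenerator, and the argument with
left `add X[d]`-approximations shows that the objects with injective image are those of `add [1, d]`
and that morphisms killed by `F` factor through `add [1, d]` as well. A full and dense functor with
these properties induces equivalences on the ideal quotients (`isEquivalence_inducedFunctor`).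

*The translation.* If `A` has no nonzero summand in `add [2-d, 1]`, then `F A` has no nonzero
morphisms to projective modules. A triangle `X ⟶ E ⟶ A ⟶ X[1]` is therefore mapped to a short exact
sequence, whose class gives `Hom(A, X[1]) ≅ Ext¹(F A, Λ)` (`IsTiltingPair.extEquiv`). Together with
duality, `F(A[d-1]) ≅ D Hom(A[d-1], X[d]) ≅ D Hom(A, X[1]) ≅ D Ext¹(F A, Λ)`, compatibly with the
action of `Λ` and naturally in `A`. Up to isomorphism in the quotient by `add [2-d, 1]` every object
is of this kind, so the isomorphism extends to the square of quotient functors; the functor induced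
by the translation is an equivalence because the other three are.

*Indecomposables.* In a Hom-finite idempotent complete category the endomorphisms of an
indecomposable object are nilpotent or invertible. A full and dense functor then induces a bijection
between the indecomposable objects that it does not kill and those of its target
(`bijOn_mapIsoClasses`), and `F` kills exactly the objects of `add T[1]`.
-/

namespace ClusterHereditary

noncomputable section

/-! ### Additive closures and ideals of morphisms -/

section Ideals

variable {C : Type*} [Category C] [Preadditive C]

/-- A class of objects that contains the zero objects and is closed under binary biproducts and
retracts (in particular under isomorphisms). -/
structure IsAddClosed [HasBinaryBiproducts C] (P : ObjectProperty C) : Prop where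
  of_isZero : ∀ A : C, IsZero A → P A
  biprod : ∀ A B : C, P A → P B → P (A ⊞ B)
  of_retract : ∀ A B : C, Retract A B → P B → P A

/-- The morphism `f` factors through an object satisfying `P`. -/
def FactorsThru (P : ObjectProperty C) {A B : C} (f : A ⟶ B) : Prop :=
  ∃ (Z : C) (_ : P Z) (a : A ⟶ Z) (b : Z ⟶ B), a ≫ b = f

lemma idealRel_iff {P : ObjectProperty C} {A B : C} (f g : A ⟶ B) :
    idealRel P f g ↔ FactorsThru P (f - g) := Iff.rfl

omit [Preadditive C] in
lemma FactorsThru.precomp {P : ObjectProperty C} {A B D : C} {f : A ⟶ B} (h : FactorsThru P f)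
    (g : D ⟶ A) : FactorsThru P (g ≫ f) := by
  obtain ⟨Z, hZ, a, b, rfl⟩ := h
  exact ⟨Z, hZ, g ≫ a, b, by simp⟩

omit [Preadditive C] in
lemma FactorsThru.postcomp {P : ObjectProperty C} {A B D : C} {f : A ⟶ B} (h : FactorsThru P f)
    (g : B ⟶ D) : FactorsThru P (f ≫ g) := by
  obtain ⟨Z, hZ, a, b, rfl⟩ := h
  exact ⟨Z, hZ, a, b ≫ g, by simp⟩

lemma FactorsThru.neg {P : ObjectProperty C} {A B : C} {f : A ⟶ B} (h : FactorsThru P f) :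
    FactorsThru P (-f) := by
  obtain ⟨Z, hZ, a, b, rfl⟩ := h
  exact ⟨Z, hZ, -a, b, by simp⟩

variable [HasFiniteBiproducts C] [HasBinaryBiproducts C]

omit [HasFiniteBiproducts C] in
lemma FactorsThru.add {P : ObjectProperty C} (hP : IsAddClosed P) {A B : C} {f g : A ⟶ B}
    (hf : FactorsThru P f) (hg : FactorsThru P g) : FactorsThru P (f + g) := by
  obtain ⟨Z, hZ, a, b, rfl⟩ := hf
  obtain ⟨Z', hZ', a', b', rfl⟩ := hg
  exact ⟨Z ⊞ Z', hP.biprod _ _ hZ hZ', biprod.lift a a', biprod.desc b b', by simp⟩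

lemma factorsThru_zero {P : ObjectProperty C} (hP : IsAddClosed P) (A B : C) :
    FactorsThru P (0 : A ⟶ B) :=
  ⟨⨁ (fun i : Fin 0 => i.elim0), hP.of_isZero _ (by
    rw [IsZero.iff_id_eq_zero]; ext i; exact i.elim0), 0, 0, by simp⟩

lemma IsAddClosed.congruence {P : ObjectProperty C} (hP : IsAddClosed P) :
    Congruence (idealRel P) where
  equivalence {A B} :=
    { refl := fun f => by
        rw [idealRel_iff, sub_self]; exact factorsThru_zero hP A B
      symm := fun {f g} h => by
        rw [idealRel_iff] at h ⊢; simpa using h.neg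
      trans := fun {f g h} h₁ h₂ => by
        rw [idealRel_iff] at h₁ h₂ ⊢; simpa using h₁.add hP h₂ }
  comp_left f _ _ h := by
    rw [idealRel_iff] at h ⊢; rw [← Preadditive.comp_sub]; exact h.precomp f
  comp_right {_ _ _ f g} k h := by
    rw [idealRel_iff] at h ⊢; rw [← Preadditive.sub_comp]; exact h.postcomp k

lemma IsAddClosed.idealProj_map_eq_iff {P : ObjectProperty C} (hP : IsAddClosed P) {A B : C}
    (f g : A ⟶ B) :
    (idealProj P).map f = (idealProj P).map g ↔ FactorsThru P (f - g) := by
  have := hP.congruence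
  rw [Quotient.functor_map_eq_iff, idealRel_iff]

lemma IsAddClosed.biproduct {P : ObjectProperty C} (hP : IsAddClosed P) :
    ∀ {n : ℕ} (A : Fin n → C), (∀ i, P (A i)) → P (⨁ A)
  | 0, A, _ => hP.of_isZero _ (by rw [IsZero.iff_id_eq_zero]; ext i; exact i.elim0)
  | n + 1, A, h => by
    refine hP.of_retract _ (A 0 ⊞ ⨁ (fun i : Fin n => A i.succ)) ⟨
      biprod.lift (biproduct.π A 0) (biproduct.lift fun i => biproduct.π A i.succ),
      biprod.desc (biproduct.ι A 0) (biproduct.desc fun i => biproduct.ι A i.succ), ?_⟩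
      (hP.biprod _ _ (h 0) (hP.biproduct _ fun i => h i.succ))
    rw [biprod.lift_desc, biproduct.lift_desc, ← biproduct.total (f := A), Fin.sum_univ_succ]

omit [HasBinaryBiproducts C] in
lemma addClosure_self (M : C) : addClosure M M :=
  ⟨1, ⟨biproduct.ι (fun _ : Fin 1 => M) 0, biproduct.π _ 0, by simp⟩⟩

/-- A property that is inherited by zero objects, sums and summands holds on `add M` if it holds
for `M`. -/
lemma addClosure_induction {M : C} {Q : ObjectProperty C} (hQ : IsAddClosed Q) (h : Q M) {A : C}
    (hA : addClosure M A) : Q A := by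
  obtain ⟨n, ⟨r⟩⟩ := hA
  exact hQ.of_retract _ _ r (hQ.biproduct _ fun _ => h)

lemma isAddClosed_addClosure (M : C) : IsAddClosed (addClosure M) where
  of_isZero A hA := ⟨0, ⟨0, 0, hA.eq_of_src _ _⟩⟩
  of_retract A B r hB := by
    obtain ⟨n, ⟨s⟩⟩ := hB
    exact ⟨n, ⟨r.trans s⟩⟩
  biprod A B hA hB := by
    obtain ⟨n, ⟨s⟩⟩ := hA
    obtain ⟨m, ⟨t⟩⟩ := hB
    refine ⟨n + m, ⟨biprod.desc (s.i ≫ biproduct.lift fun j =>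
        Fin.addCases (fun i => biproduct.π _ i) (fun _ => 0) j)
      (t.i ≫ biproduct.lift fun j => Fin.addCases (fun _ => 0) (fun i => biproduct.π _ i) j),
      biproduct.desc fun j =>
        Fin.addCases (fun i => biproduct.ι (fun _ : Fin n => M) i ≫ s.r ≫ biprod.inl)
        (fun i => biproduct.ι (fun _ : Fin m => M) i ≫ t.r ≫ biprod.inr) j, ?_⟩⟩
    · have h₁ : (∑ j : Fin n, biproduct.π (fun _ => M) j ≫ biproduct.ι (fun _ => M) j ≫ s.r ≫
          (biprod.inl : A ⟶ A ⊞ B)) = s.r ≫ biprod.inl := by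
        simp only [← Category.assoc, ← Preadditive.sum_comp, biproduct.total, Category.id_comp]
      have h₂ : (∑ j : Fin m, biproduct.π (fun _ => M) j ≫ biproduct.ι (fun _ => M) j ≫ t.r ≫
          (biprod.inr : B ⟶ A ⊞ B)) = t.r ≫ biprod.inr := by
        simp only [← Category.assoc, ← Preadditive.sum_comp, biproduct.total, Category.id_comp]
      apply biprod.hom_ext'
      · simp [biproduct.lift_desc, Fin.sum_univ_add, h₁]
      · simp [biproduct.lift_desc, Fin.sum_univ_add, h₂]

/-- The functor induced on ideal quotients by a functor that maps `P` into `Q`. -/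
def inducedFunctor {D : Type*} [Category D] [Preadditive D] [HasFiniteBiproducts D]
    [HasBinaryBiproducts D]
    {P : ObjectProperty C} {Q : ObjectProperty D} (hQ : IsAddClosed Q) (F : C ⥤ D) [F.Additive]
    (h : ∀ A, P A → Q (F.obj A)) : IdealQuotient P ⥤ IdealQuotient Q :=
  CategoryTheory.Quotient.lift _ (F ⋙ idealProj Q) fun A B f g ⟨Z, hZ, a, b, e⟩ =>
    (hQ.idealProj_map_eq_iff _ _).2
      ⟨F.obj Z, h Z hZ, F.map a, F.map b, by rw [← F.map_comp, e, F.map_sub]⟩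

section Induced

variable {D : Type*} [Category D] [Preadditive D] [HasFiniteBiproducts D]
    [HasBinaryBiproducts D]
    {P : ObjectProperty C} {Q : ObjectProperty D} (hP : IsAddClosed P) (hQ : IsAddClosed Q)
    (F : C ⥤ D) [F.Additive] (h : ∀ A, P A → Q (F.obj A))

omit [HasFiniteBiproducts C] [HasBinaryBiproducts C] in
lemma isInducedBy_inducedFunctor : IsInducedBy F (inducedFunctor hQ F h) :=
  CategoryTheory.Quotient.lift_spec _ _ _

include hP in
/-- A full and dense functor `F : C ⥤ D` induces an equivalence `C / [P] ≌ D / [Q]` as soon as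
every morphism `f` for which `F f` factors through `Q` factors through `P`. -/
lemma isEquivalence_inducedFunctor [F.Full] (hd : ∀ M : D, ∃ A : C, Nonempty (F.obj A ≅ M))
    (hf : ∀ (A B : C) (f : A ⟶ B), FactorsThru Q (F.map f) → FactorsThru P f) :
    (inducedFunctor hQ F h).IsEquivalence := by
  have hfull : (inducedFunctor hQ F h).Full := ⟨fun {A B} g => by
    obtain ⟨g', rfl⟩ := (idealProj Q).map_surjective (X := F.obj A.as) (Y := F.obj B.as) g
    obtain ⟨f, rfl⟩ := F.map_surjective g'
    exact ⟨(idealProj P).map f, rfl⟩⟩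
  have hfaith : (inducedFunctor hQ F h).Faithful := ⟨fun {A B} f g e => by
    obtain ⟨f, rfl⟩ := (idealProj P).map_surjective (X := A.as) (Y := B.as) f
    obtain ⟨g, rfl⟩ := (idealProj P).map_surjective (X := A.as) (Y := B.as) g
    have e' : (idealProj Q).map (F.map f) = (idealProj Q).map (F.map g) := e
    rw [hQ.idealProj_map_eq_iff, ← F.map_sub] at e'
    exact (hP.idealProj_map_eq_iff _ _).2 (hf _ _ _ e')⟩
  have hess : (inducedFunctor hQ F h).EssSurj := ⟨fun M => by
    obtain ⟨A, ⟨e⟩⟩ := hd M.as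
    exact ⟨(idealProj P).obj A, ⟨(idealProj Q).mapIso e⟩⟩⟩
  exact { }

end Induced

end Ideals

/-! ### Direct summands and idempotents -/

section Summands

variable {C : Type*} [Category C] [Preadditive C] [IsIdempotentComplete C]

/-- An idempotent that factors both through an object of `P` and through an object without
nonzero summands in `P` vanishes, because its image is a summand of both. -/
lemma idempotent_eq_zero [HasBinaryBiproducts C] {P : ObjectProperty C} (hP : IsAddClosed P)
    {K B Z : C} {e : K ⟶ K} (he : e ≫ e = e) {a : K ⟶ B} {b : B ⟶ K} (hab : a ≫ b = e)
    (hB : noSummandIn P B) {p : K ⟶ Z} {q : Z ⟶ K} (hpq : p ≫ q = e) (hZ : P Z) : e = 0 := by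
  obtain ⟨Y, i, r, hir, hri⟩ := IsIdempotentComplete.idempotents_split K e he
  have key : i ≫ e ≫ r = 𝟙 Y := by rw [← hri]; simp [hir]
  have hY : P Y := hP.of_retract Y Z ⟨i ≫ p, q ≫ r, by simpa [← reassoc_of% hpq] using key⟩ hZ
  have h0 := hB Y hY ⟨⟨i ≫ a, b ≫ r, by simpa [← reassoc_of% hab] using key⟩⟩
  rw [← hri, h0.eq_of_src i 0, comp_zero]

/-- Retracts are direct summands: the complementary idempotent splits. -/
lemma exists_complement {A B : C} (r : Retract B A) :
    ∃ (A' : C) (i : A' ⟶ A) (p : A ⟶ A'), i ≫ p = 𝟙 A' ∧ p ≫ i = 𝟙 A - r.r ≫ r.i := by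
  obtain ⟨A', i, p, h₁, h₂⟩ := IsIdempotentComplete.idempotents_split A (𝟙 A - r.r ≫ r.i)
    (by simp [Preadditive.comp_sub, Preadditive.sub_comp])
  exact ⟨A', i, p, h₁, h₂⟩

/-- In a Hom-finite category every object is, up to a summand in `P`, an object without nonzero
summands in `P`. -/
lemma exists_noSummandIn {k : Type*} [Field k] {C : Type u} [Category.{v} C] [Preadditive C]
    [HasFiniteBiproducts C] [HasBinaryBiproducts C] [IsIdempotentComplete C] [Linear k C]
    (hk : ∀ A B : C, Module.Finite k (A ⟶ B)) {P : ObjectProperty C} (hP : IsAddClosed P)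
    (A : C) : ∃ (A' : C) (i : A' ⟶ A) (p : A ⟶ A'), i ≫ p = 𝟙 A' ∧
      FactorsThru P (𝟙 A - p ≫ i) ∧ noSummandIn P A' := by
  induction hn : Module.finrank k (A ⟶ A) using Nat.strong_induction_on generalizing A with
  | _ n ih =>
  by_cases hA : noSummandIn P A
  · exact ⟨A, 𝟙 A, 𝟙 A, by simp, by simpa using factorsThru_zero hP A A, hA⟩
  · simp only [noSummandIn, not_forall] at hA
    obtain ⟨B, hB, ⟨r⟩, hB0⟩ := hA
    obtain ⟨A₁, i, p, hip, hpi⟩ := exists_complement r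
    have hrp : r.i ≫ p = 0 := by
      have : r.i ≫ p ≫ i = 0 := by rw [hpi]; simp [Preadditive.comp_sub]
      have h2 := this =≫ p
      simpa [hip] using h2
    have := hk A A
    have := hk A₁ A₁
    let L : (A₁ ⟶ A₁) →ₗ[k] (A ⟶ A) :=
      (Linear.leftComp k A p).comp (Linear.rightComp k A₁ i)
    have hL : ∀ f, L f = p ≫ f ≫ i := fun f => rfl
    have hinj : Function.Injective L := fun f g h => by
      have := i ≫= h =≫ p
      simpa [hL, hip, reassoc_of% hip] using this
    -- The embedding `L` misses the identity, because `L f` vanishes on the nonzero summand `B`.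
    have hlt : Module.finrank k (A₁ ⟶ A₁) < Module.finrank k (A ⟶ A) := by
      rw [← LinearMap.finrank_range_of_inj hinj]
      refine Submodule.finrank_lt fun htop => hB0 ?_
      obtain ⟨f, hf⟩ : 𝟙 A ∈ LinearMap.range L := htop ▸ Submodule.mem_top
      rw [IsZero.iff_id_eq_zero, ← r.retract]
      rw [← Category.id_comp r.r, ← hf, hL]
      simp [reassoc_of% hrp]
    obtain ⟨A', i', p', h₁, h₂, h₃⟩ := ih _ (hn ▸ hlt) A₁ rfl
    refine ⟨A', i' ≫ i, p ≫ p', by simp [reassoc_of% hip, h₁], ?_, h₃⟩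
    have e : 𝟙 A - (p ≫ p') ≫ i' ≫ i = r.r ≫ r.i + p ≫ (𝟙 A₁ - p' ≫ i') ≫ i := by
      simp only [Preadditive.comp_sub, Preadditive.sub_comp, Category.id_comp, hpi,
        Category.assoc]
      abel
    rw [e]
    exact FactorsThru.add hP ⟨B, hB, r.r, r.i, rfl⟩ ((h₂.postcomp i).precomp p)

/-- Endomorphism rings of indecomposable objects have no nontrivial idempotents. -/
lemma IsIndecomposable.idempotent {A : C} (hA : IsIndecomposable A) {e : A ⟶ A}
    (he : e ≫ e = e) : e = 0 ∨ e = 𝟙 A := by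
  obtain ⟨Y, i, p, hip, hpi⟩ := IsIdempotentComplete.idempotents_split A e he
  obtain ⟨Z, j, q, hjq, hqj⟩ := exists_complement (⟨i, p, hip⟩ : Retract Y A)
  dsimp only at hqj
  have hjp : j ≫ p = 0 := by
    have : q ≫ j ≫ p = 0 := by rw [reassoc_of% hqj]; simp [Preadditive.sub_comp, hip]
    have h2 := j ≫= this
    simpa [reassoc_of% hjq] using h2
  have hiq : i ≫ q = 0 := by
    have : i ≫ q ≫ j = 0 := by rw [hqj]; simp [Preadditive.comp_sub, reassoc_of% hip]
    have h2 := this =≫ q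
    simpa [hjq] using h2
  let b : BinaryBicone Y Z :=
    { pt := A, fst := p, snd := q, inl := i, inr := j, inl_fst := hip, inr_snd := hjq,
      inl_snd := hiq, inr_fst := hjp }
  have hb : b.IsBilimit := isBinaryBilimitOfTotal b (by
    change p ≫ i + q ≫ j = 𝟙 A
    rw [hqj]; simp)
  rcases hA.2 Y Z b hb ⟨Iso.refl A⟩ with h | h
  · left; rw [← hpi, h.eq_of_src i 0, comp_zero]
  · right
    have : q ≫ j = 0 := by rw [h.eq_of_src j 0, comp_zero]
    rw [hqj, sub_eq_zero] at this
    rw [← hpi, ← this]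

/-- Fitting's lemma: over a field, an element of a finite dimensional algebra without nontrivial
idempotents is nilpotent or invertible. -/
lemma isNilpotent_or_isUnit {k R : Type*} [Field k] [Ring R] [Algebra k R] [Module.Finite k R]
    (h : ∀ e : R, e * e = e → e = 0 ∨ e = 1) (x : R) : IsNilpotent x ∨ IsUnit x := by
  rcases subsingleton_or_nontrivial R with hR | hR
  · exact Or.inr ⟨1, Subsingleton.elim _ _⟩
  have hx : IsIntegral k x := Algebra.IsIntegral.isIntegral x
  have hp0 := minpoly.ne_zero hx
  -- Write the minimal polynomial as `X ^ n * q` with `q` prime to `X`.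
  obtain ⟨q, hq, hq0⟩ := Polynomial.exists_eq_pow_rootMultiplicity_mul_and_not_dvd _ hp0 0
  set n := Polynomial.rootMultiplicity 0 (minpoly k x)
  rw [Polynomial.C_0, sub_zero] at hq hq0
  have hco : IsCoprime (Polynomial.X ^ (n + 1)) q :=
    ((Polynomial.prime_X (R := k)).irreducible.coprime_iff_not_dvd.2 hq0).pow_left
  obtain ⟨a, b, hab⟩ := hco
  have haev := congrArg (Polynomial.aeval x) hab
  have hz : Polynomial.aeval x (Polynomial.X ^ n * q) = 0 := hq ▸ minpoly.aeval k x
  simp only [map_add, map_mul, map_pow, Polynomial.aeval_X, map_one] at haev hz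
  set a' := Polynomial.aeval x a
  set b' := Polynomial.aeval x b
  set q' := Polynomial.aeval x q
  have hxq : x ^ (n + 1) * q' = 0 := by rw [pow_succ', mul_assoc, hz, mul_zero]
  have hcomm : ∀ f g : Polynomial k, Polynomial.aeval x f * Polynomial.aeval x g =
      Polynomial.aeval x g * Polynomial.aeval x f := fun f g => by
    rw [← map_mul, mul_comm, map_mul]
  have hzero : (a' * x ^ (n + 1)) * (b' * q') = 0 := by
    have : x ^ (n + 1) * (b' * q') = 0 := by
      rw [hcomm b q, ← mul_assoc, hxq, zero_mul]
    rw [mul_assoc, this, mul_zero]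
  have hid : (a' * x ^ (n + 1)) * (a' * x ^ (n + 1)) = a' * x ^ (n + 1) := by
    conv_rhs => rw [← mul_one (a' * x ^ (n + 1)), ← haev, mul_add, hzero, add_zero]
  rcases h _ hid with h0 | h1
  · left
    refine ⟨n + 1, ?_⟩
    rw [h0, zero_add] at haev
    rw [← mul_one (x ^ (n + 1)), ← haev, hcomm b q, ← mul_assoc, hxq, zero_mul]
  · right
    have hc : a' * x ^ n * x = x * (a' * x ^ n) := by
      have := hcomm (a * Polynomial.X ^ n) Polynomial.X
      simpa using this
    rw [pow_succ, ← mul_assoc] at h1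
    exact ⟨⟨x, a' * x ^ n, hc ▸ h1, h1⟩, rfl⟩

/-- An endomorphism of an indecomposable object of a Hom-finite category is nilpotent or
invertible. -/
lemma IsIndecomposable.isNilpotent_or_isUnit (k : Type*) [Field k] [Linear k C] {A : C}
    [Module.Finite k (A ⟶ A)] (hA : IsIndecomposable A) (f : End A) :
    IsNilpotent f ∨ IsUnit f :=
  have : Module.Finite k (End A) := ‹Module.Finite k (A ⟶ A)›
  ClusterHereditary.isNilpotent_or_isUnit (k := k) (fun _ he => hA.idempotent he) f

end Summands

/-! ### Modules over hereditary rings -/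

section Modules

/-- In an abelian category with enough projectives in which subobjects of projectives are
projective, quotients of injectives are injective: an extension problem along `j : A ⟶ B` is
lifted to the pullback of `j` along an epimorphism from a projective object. -/
lemma injective_of_epi {𝒜 : Type*} [Category 𝒜] [Abelian 𝒜] [EnoughProjectives 𝒜]
    (hsub : ∀ (M N : 𝒜) (f : M ⟶ N) [Mono f], Projective N → Projective M)
    {M N : 𝒜} (f : M ⟶ N) [Epi f] [Injective M] : Injective N where
  factors {A B} g j _ := by
    let π : Projective.over B ⟶ B := Projective.π B
    have := hsub _ _ (pullback.snd j π) (Projective.projective_over B)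
    let h : pullback j π ⟶ M := Projective.factorThru (pullback.fst j π ≫ g) f
    let t : Projective.over B ⟶ N := Injective.factorThru h (pullback.snd j π) ≫ f
    have ht : pullback.snd j π ≫ t = pullback.fst j π ≫ g := by simp [t, h]
    have hk : kernel.ι π ≫ t = 0 := by
      have : kernel.ι π = pullback.lift 0 (kernel.ι π)
          (by rw [zero_comp, kernel.condition]) ≫ pullback.snd j π := by
        rw [pullback.lift_snd]
      rw [this, Category.assoc, ht, pullback.lift_fst_assoc, zero_comp]
    refine ⟨Abelian.epiDesc π t hk, ?_⟩
    rw [← cancel_epi (pullback.fst j π), pullback.condition_assoc, Abelian.comp_epiDesc, ht]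

variable {Λ : Type v} [Ring Λ]

/-- If all left ideals are projective, then so are all submodules of finite free modules. -/
lemma projective_submodule_pi (h : ∀ I : Submodule Λ Λ, Module.Projective Λ I) :
    ∀ (n : ℕ) (N : Submodule Λ (Fin n → Λ)), Module.Projective Λ N
  | 0, N => inferInstance
  | n + 1, N => by
    let p : N →ₗ[Λ] Λ := (LinearMap.proj 0).comp N.subtype
    let q : N →ₗ[Λ] (Fin n → Λ) := (LinearMap.funLeft Λ Λ Fin.succ).comp N.subtype
    have := h (LinearMap.range p)
    obtain ⟨s, hs⟩ := Module.projective_lifting_property p.rangeRestrict LinearMap.id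
      p.surjective_rangeRestrict
    have hps : ∀ x, p (s x) = x := fun x => congrArg Subtype.val (LinearMap.congr_fun hs x)
    have := projective_submodule_pi h n (LinearMap.range (q.domRestrict (LinearMap.ker p)))
    have hq : Function.Injective (q.domRestrict (LinearMap.ker p)) := fun x y hxy => by
      ext i
      refine Fin.cases ?_ (fun j => congrFun hxy j) i
      exact (LinearMap.mem_ker.1 x.2).trans (LinearMap.mem_ker.1 y.2).symm
    have : Module.Projective Λ (LinearMap.ker p) :=
      Module.Projective.of_equiv (LinearEquiv.ofInjective _ hq).symm
    have hker : ∀ x, x - s (p.rangeRestrict x) ∈ LinearMap.ker p := fun x => by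
      rw [LinearMap.mem_ker, map_sub, hps, sub_eq_zero]; rfl
    let a : N →ₗ[Λ] LinearMap.ker p × LinearMap.range p :=
      ((LinearMap.id - s.comp p.rangeRestrict).codRestrict _ hker).prod p.rangeRestrict
    let b : LinearMap.ker p × LinearMap.range p →ₗ[Λ] N :=
      (LinearMap.ker p).subtype.coprod s
    exact Module.Projective.of_split a b (LinearMap.ext fun x => by simp [a, b])

/-- Right ideals of `R` are the left ideals of the opposite ring. -/
lemma IsHereditary.projective_ideal {R : Type*} [Ring R] (h : IsHereditary R)
    (I : Submodule Rᵐᵒᵖ Rᵐᵒᵖ) : Module.Projective Rᵐᵒᵖ I := by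
  let e : R ≃ₗ[Rᵐᵒᵖ] Rᵐᵒᵖ :=
    { MulOpposite.opAddEquiv with map_smul' := fun _ _ => rfl }
  have := h.2 (I.comap e.toLinearMap)
  exact Module.Projective.of_equiv (e.submoduleMap (I.comap e.toLinearMap) |>.trans
    (LinearEquiv.ofEq _ _ (Submodule.map_comap_eq_of_surjective e.surjective I)))

variable [IsNoetherianRing Λ]

lemma fgModuleCat_surjective {M N : FGModuleCat.{v} Λ} (f : M ⟶ N) [Epi f] :
    Function.Surjective f.hom.hom :=
  (ModuleCat.epi_iff_surjective _).1
    (inferInstanceAs (Epi ((forget₂ (FGModuleCat.{v} Λ) (ModuleCat.{v} Λ)).map f)))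

lemma fgModuleCat_injective {M N : FGModuleCat.{v} Λ} (f : M ⟶ N) [Mono f] :
    Function.Injective f.hom.hom :=
  (ModuleCat.mono_iff_injective _).1
    (inferInstanceAs (Mono ((forget₂ (FGModuleCat.{v} Λ) (ModuleCat.{v} Λ)).map f)))

omit [IsNoetherianRing Λ] in
lemma fgModuleCat_epi {M N : FGModuleCat.{v} Λ} (f : M ⟶ N)
    (h : Function.Surjective f.hom.hom) : Epi f :=
  (forget₂ (FGModuleCat.{v} Λ) (ModuleCat.{v} Λ)).epi_of_epi_map
    ((ModuleCat.epi_iff_surjective _).2 h)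

omit [IsNoetherianRing Λ] in
lemma fgModuleCat_mono {M N : FGModuleCat.{v} Λ} (f : M ⟶ N)
    (h : Function.Injective f.hom.hom) : Mono f :=
  (forget₂ (FGModuleCat.{v} Λ) (ModuleCat.{v} Λ)).mono_of_mono_map
    ((ModuleCat.mono_iff_injective _).2 h)

lemma fgModuleCat_projective_iff (M : FGModuleCat.{v} Λ) :
    Projective M ↔ Module.Projective Λ M := by
  constructor
  · intro hM
    obtain ⟨n, f, hf⟩ := Module.Finite.exists_fin' Λ M
    let f' : FGModuleCat.of Λ (Fin n → Λ) ⟶ M := FGModuleCat.ofHom f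
    have : Epi f' := fgModuleCat_epi f' hf
    let s := Projective.factorThru (𝟙 M) f'
    refine Module.Projective.of_split s.hom.hom f (LinearMap.ext fun x => ?_)
    have h : s ≫ f' = 𝟙 M := Projective.factorThru_comp _ _
    exact LinearMap.congr_fun (congrArg (fun g => g.hom.hom) h) x
  · intro hM
    refine ⟨fun {E Y} f e _ => ?_⟩
    obtain ⟨g, hg⟩ := Module.projective_lifting_property e.hom.hom f.hom.hom
      (fgModuleCat_surjective e)
    exact ⟨FGModuleCat.ofHom g, FGModuleCat.hom_ext hg⟩

instance : EnoughProjectives (FGModuleCat.{v} Λ) where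
  presentation M := by
    obtain ⟨n, f, hf⟩ := Module.Finite.exists_fin' Λ M
    let f' : FGModuleCat.of Λ (Fin n → Λ) ⟶ M := FGModuleCat.ofHom f
    exact ⟨{ p := _, projective := (fgModuleCat_projective_iff _).2
               (inferInstanceAs (Module.Projective Λ (Fin n → Λ))),
             f := f', epi := fgModuleCat_epi f' hf }⟩

/-- If all left ideals are projective, then so are all submodules of finitely generated projective
modules. -/
lemma projective_of_mono (h : ∀ I : Submodule Λ Λ, Module.Projective Λ I)
    {M N : FGModuleCat.{v} Λ} (f : M ⟶ N) [Mono f] (hN : Projective N) : Projective M := by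
  rw [fgModuleCat_projective_iff] at hN ⊢
  obtain ⟨n, g, hg⟩ := Module.Finite.exists_fin' Λ N
  obtain ⟨s, hs⟩ := Module.projective_lifting_property g LinearMap.id hg
  have hsi : Function.Injective s := Function.LeftInverse.injective (LinearMap.congr_fun hs)
  have hi : Function.Injective (s.comp f.hom.hom) := hsi.comp (fgModuleCat_injective f)
  have := projective_submodule_pi h n (LinearMap.range (s.comp f.hom.hom))
  exact Module.Projective.of_equiv (LinearEquiv.ofInjective _ hi).symm

lemma isAddClosed_projective {𝒜 : Type*} [Category 𝒜] [Preadditive 𝒜] [HasBinaryBiproducts 𝒜] :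
    IsAddClosed (C := 𝒜) (fun M => Projective M) where
  of_isZero _ h := h.projective
  biprod _ _ hA hB := by
    have := hA; have := hB; infer_instance
  of_retract _ _ r h := ⟨fun f e _ => by
    have := h
    exact ⟨r.i ≫ Projective.factorThru (r.r ≫ f) e, by simp⟩⟩

lemma isAddClosed_injective {𝒜 : Type*} [Category 𝒜] [Preadditive 𝒜] [HasBinaryBiproducts 𝒜] :
    IsAddClosed (C := 𝒜) (fun M => Injective M) where
  of_isZero _ h := h.injective
  biprod _ _ hA hB := by
    have := hA; have := hB; infer_instance
  of_retract _ _ r h := ⟨fun f e _ => by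
    have := h
    exact ⟨Injective.factorThru (f ≫ r.i) e ≫ r.r, by simp⟩⟩

lemma IsAddClosed.comap {C D : Type*} [Category C] [Preadditive C] [HasBinaryBiproducts C]
    [Category D] [Preadditive D] [HasBinaryBiproducts D] {Q : ObjectProperty D}
    (hQ : IsAddClosed Q) (F : C ⥤ D) [F.Additive] : IsAddClosed (fun A => Q (F.obj A)) where
  of_isZero _ h := hQ.of_isZero _ (F.map_isZero h)
  biprod A B hA hB := hQ.of_retract _ (F.obj A ⊞ F.obj B)
    ⟨biprod.lift (F.map biprod.fst) (F.map biprod.snd),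
      biprod.desc (F.map biprod.inl) (F.map biprod.inr), by
        rw [biprod.lift_desc, ← F.map_comp, ← F.map_comp, ← F.map_add, biprod.total, F.map_id]⟩
      (hQ.biprod _ _ hA hB)
  of_retract _ _ r h := hQ.of_retract _ _ (r.map F) h

end Modules

/-! ### The classes of summands of sums of shifts of an object -/

section ShiftAdd

variable {C : Type u} [Category.{v} C] [Preadditive C] [HasFiniteBiproducts C]
  [HasBinaryBiproducts C]

omit [HasFiniteBiproducts C] in
lemma isAddClosed_hom_from_zero (B : C) : IsAddClosed (fun A : C => ∀ f : A ⟶ B, f = 0) where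
  of_isZero _ h f := h.eq_of_src _ _
  biprod _ _ hA hB f := by ext <;> simp [hA, hB]
  of_retract _ _ r h f := by
    rw [← Category.id_comp f, ← r.retract, Category.assoc, h (r.r ≫ f), comp_zero]

omit [HasFiniteBiproducts C] in
lemma isAddClosed_hom_to_zero (B : C) : IsAddClosed (fun A : C => ∀ f : B ⟶ A, f = 0) where
  of_isZero _ h f := h.eq_of_tgt _ _
  biprod _ _ hA hB f := by
    ext
    · rw [hA (f ≫ biprod.fst), zero_comp]
    · rw [hB (f ≫ biprod.snd), zero_comp]
  of_retract _ _ r h f := by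
    rw [← Category.comp_id f, ← r.retract, ← Category.assoc, h (f ≫ r.i), zero_comp]

omit [HasFiniteBiproducts C] in
lemma isAddClosed_injective_comp {A B : C} (j : A ⟶ B) :
    IsAddClosed (fun Z : C => ∀ z : Z ⟶ A, z ≫ j = 0 → z = 0) where
  of_isZero _ h f _ := h.eq_of_src _ _
  biprod _ _ hA hB f hf := by
    ext
    · rw [hA (biprod.inl ≫ f) (by rw [Category.assoc, hf, comp_zero]), comp_zero]
    · rw [hB (biprod.inr ≫ f) (by rw [Category.assoc, hf, comp_zero]), comp_zero]
  of_retract _ _ r h f hf := by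
    rw [← Category.id_comp f, ← r.retract, Category.assoc,
      h (r.r ≫ f) (by rw [Category.assoc, hf, comp_zero]), comp_zero]

omit [HasFiniteBiproducts C] in
lemma isAddClosed_surjective_comp {A B : C} (j : A ⟶ B) :
    IsAddClosed (fun Z : C => ∀ z : Z ⟶ B, ∃ y : Z ⟶ A, y ≫ j = z) where
  of_isZero _ h f := ⟨0, h.eq_of_src _ _⟩
  biprod _ _ hA hB f := by
    obtain ⟨a, ha⟩ := hA (biprod.inl ≫ f)
    obtain ⟨b, hb⟩ := hB (biprod.inr ≫ f)
    exact ⟨biprod.desc a b, by ext <;> simp [ha, hb]⟩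
  of_retract _ _ r h f := by
    obtain ⟨a, ha⟩ := h (r.r ≫ f)
    exact ⟨r.i ≫ a, by simp [ha]⟩

variable [HasShift C ℤ]

/-- The closure of the shifts `T[j]`, `a ≤ j ≤ b`, under finite direct sums and direct
summands, described by its induction principle. -/
def shiftAdd (T : C) (a b : ℤ) : ObjectProperty C := fun A =>
  ∀ Q : ObjectProperty C, IsAddClosed Q → (∀ j : ℤ, a ≤ j → j ≤ b → Q (T⟦j⟧)) → Q A

variable {T : C}

omit [HasFiniteBiproducts C] in
lemma isAddClosed_shiftAdd (T : C) (a b : ℤ) : IsAddClosed (shiftAdd T a b) where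
  of_isZero _ hA _ hQ _ := hQ.of_isZero _ hA
  biprod _ _ hA hB Q hQ h := hQ.biprod _ _ (hA Q hQ h) (hB Q hQ h)
  of_retract _ _ r hB Q hQ h := hQ.of_retract _ _ r (hB Q hQ h)

omit [HasFiniteBiproducts C] in
lemma shiftAdd_shift_self {a b j : ℤ} (h₁ : a ≤ j) (h₂ : j ≤ b) : shiftAdd T a b (T⟦j⟧) :=
  fun _ _ h => h j h₁ h₂

omit [HasFiniteBiproducts C] in
lemma shiftAdd_mono {a b a' b' : ℤ} (h₁ : a' ≤ a) (h₂ : b ≤ b') {A : C}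
    (h : shiftAdd T a b A) : shiftAdd T a' b' A :=
  h _ (isAddClosed_shiftAdd T a' b') fun _ h₃ h₄ =>
    shiftAdd_shift_self (h₁.trans h₃) (h₄.trans h₂)

omit [HasFiniteBiproducts C] in
lemma shiftAdd_shift [∀ n : ℤ, (shiftFunctor C n).Additive] {a b a' b' : ℤ} (n : ℤ)
    (ha : a + n = a') (hb : b + n = b') {A : C} (h : shiftAdd T a b A) :
    shiftAdd T a' b' (A⟦n⟧) :=
  h _ ((isAddClosed_shiftAdd T a' b').comap (shiftFunctor C n)) fun j h₁ h₂ =>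
    (isAddClosed_shiftAdd T a' b').of_retract _ _
      (Retract.ofIso ((shiftFunctorAdd C j n).symm.app T))
      (shiftAdd_shift_self (by lia) (by lia))

lemma addClosure_iff_shiftAdd {M : C} {a b : ℤ} (h₁ : shiftAdd T a b M)
    (h₂ : ∀ j, a ≤ j → j ≤ b → addClosure M (T⟦j⟧)) (A : C) :
    addClosure M A ↔ shiftAdd T a b A :=
  ⟨addClosure_induction (isAddClosed_shiftAdd T a b) h₁,
    fun h => h _ (isAddClosed_addClosure M) h₂⟩

lemma addClosure_shift_iff (T : C) (j : ℤ) (A : C) :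
    addClosure (T⟦j⟧) A ↔ shiftAdd T j j A :=
  addClosure_iff_shiftAdd (shiftAdd_shift_self le_rfl le_rfl) (fun i h₁ h₂ => by
    obtain rfl := le_antisymm h₁ h₂
    exact addClosure_self _) A

lemma addClosure_iff_shiftAdd_zero (T A : C) : addClosure T A ↔ shiftAdd T 0 0 A :=
  addClosure_iff_shiftAdd ((isAddClosed_shiftAdd T 0 0).of_retract _ _
      (Retract.ofIso ((shiftFunctorZero C ℤ).symm.app T))
      (shiftAdd_shift_self le_rfl le_rfl)) (fun i h₁ h₂ => by
    obtain rfl := le_antisymm h₁ h₂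
    exact (isAddClosed_addClosure T).of_retract _ _
      (Retract.ofIso ((shiftFunctorZero C ℤ).app T)) (addClosure_self T)) A

lemma addClosure_shiftedSum_iff (d : ℕ) (hd : 2 ≤ d) (T A : C) :
    addClosure (shiftedSum d T) A ↔ shiftAdd T (2 - d) 0 A := by
  refine addClosure_iff_shiftAdd ((isAddClosed_shiftAdd T _ _).biproduct _ fun i =>
    shiftAdd_shift_self ?_ ?_) (fun j h₁ h₂ => ?_) A
  · have := i.2; lia
  · lia
  · obtain ⟨n, rfl⟩ : ∃ n : ℕ, j = -(n : ℤ) := ⟨j.natAbs, by lia⟩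
    have hn : n < d - 1 := by lia
    refine (isAddClosed_addClosure _).of_retract _ (shiftedSum d T) ?_ (addClosure_self _)
    exact ⟨biproduct.ι (fun i : Fin (d - 1) => T⟦-((i : ℕ) : ℤ)⟧) ⟨n, hn⟩,
      biproduct.π (fun i : Fin (d - 1) => T⟦-((i : ℕ) : ℤ)⟧) ⟨n, hn⟩,
      biproduct.ι_π_self (fun i : Fin (d - 1) => T⟦-((i : ℕ) : ℤ)⟧) ⟨n, hn⟩⟩

/-- If `add M` and `add N` consist of the summands of sums of two adjacent ranges of shifts
of `T`, then `add (M ⊞ N)` belongs to the union of the ranges. -/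
lemma addClosure_biprod_iff {M N : C} {a b c : ℤ} (hab : a ≤ b + 1) (hbc : b ≤ c)
    (hM : ∀ A, addClosure M A ↔ shiftAdd T a b A)
    (hN : ∀ A, addClosure N A ↔ shiftAdd T (b + 1) c A) (A : C) :
    addClosure (M ⊞ N) A ↔ shiftAdd T a c A := by
  refine addClosure_iff_shiftAdd ((isAddClosed_shiftAdd T _ _).biprod _ _
    (shiftAdd_mono le_rfl hbc ((hM M).1 (addClosure_self M)))
    (shiftAdd_mono hab le_rfl ((hN N).1 (addClosure_self N)))) (fun j h₁ h₂ => ?_) A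
  have hadd := isAddClosed_addClosure (M ⊞ N)
  rcases le_or_gt j b with h | h
  · exact addClosure_induction hadd (hadd.of_retract _ _ ⟨biprod.inl, biprod.fst, by simp⟩
      (addClosure_self _)) ((hM _).2 (shiftAdd_shift_self h₁ h))
  · exact addClosure_induction hadd (hadd.of_retract _ _ ⟨biprod.inr, biprod.snd, by simp⟩
      (addClosure_self _)) ((hN _).2 (shiftAdd_shift_self h h₂))

omit [Preadditive C] [HasFiniteBiproducts C] [HasBinaryBiproducts C] in
/-- Every morphism `A ⟶ B⟦n⟧` is, up to the identification of `A` with `A⟦-n⟧⟦n⟧`, the shift of a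
morphism `A⟦-n⟧ ⟶ B`. -/
lemma exists_unshift {A B : C} (n m : ℤ) (h : m + n = 0) (f : A ⟶ B⟦n⟧) :
    ∃ g : A⟦m⟧ ⟶ B, f = (shiftFunctorCompIsoId C m n h).inv.app A ≫ g⟦n⟧' := by
  obtain ⟨g, hg⟩ := (shiftFunctor C n).map_surjective
    ((shiftFunctorCompIsoId C m n h).hom.app A ≫ f)
  exact ⟨g, by rw [hg]; simp⟩

omit [HasFiniteBiproducts C] [HasBinaryBiproducts C] in
lemma injective_comp_shift {A B Z : C} (j : A ⟶ B) (n m : ℤ) (h : m + n = 0)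
    [(shiftFunctor C n).Additive] (hj : ∀ z : Z⟦m⟧ ⟶ A, z ≫ j = 0 → z = 0) (y : Z ⟶ A⟦n⟧)
    (hy : y ≫ j⟦n⟧' = 0) : y = 0 := by
  obtain ⟨g, rfl⟩ := exists_unshift n m h y
  have h0 : g ≫ j = 0 := by
    apply (shiftFunctor C n).map_injective
    rw [Functor.map_comp, Functor.map_zero,
      ← cancel_epi ((shiftFunctorCompIsoId C m n h).inv.app Z), ← Category.assoc, hy, comp_zero]
  rw [hj g h0, Functor.map_zero, comp_zero]

end ShiftAdd

/-! ### The functor `Hom(X, -)` on objects of `add X` -/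

section HomFunctor

variable {k : Type v} [Field k] {C : Type u} [Category.{v} C] [Preadditive C] [Linear k C]
  [HomFinite k C] (X : C)

instance : (homFunctor k X).Additive where
  map_add := by
    intros
    refine FGModuleCat.hom_ext (LinearMap.ext fun x => ?_)
    exact Preadditive.comp_add _ _ _ _ _ _

include k in
lemma isNoetherianRing_end : IsNoetherianRing (End X)ᵐᵒᵖ := isNoetherian_of_tower k
  (inferInstanceAs (IsNoetherian k (End X)ᵐᵒᵖ))

variable {X}

lemma homFunctor_map_eq_zero_iff {A B : C} (f : A ⟶ B) :
    (homFunctor k X).map f = 0 ↔ ∀ x : X ⟶ A, x ≫ f = 0 :=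
  ⟨fun h x => LinearMap.congr_fun (congrArg (fun g => g.hom.hom) h) x,
    fun h => FGModuleCat.hom_ext (LinearMap.ext h)⟩

lemma homFunctor_obj_isZero_iff {A : C} :
    IsZero ((homFunctor k X).obj A) ↔ ∀ x : X ⟶ A, x = 0 := by
  rw [IsZero.iff_id_eq_zero, ← CategoryTheory.Functor.map_id, homFunctor_map_eq_zero_iff]
  simp

lemma homFunctor_mono {A B : C} (f : A ⟶ B) (h : ∀ x : X ⟶ A, x ≫ f = 0 → x = 0) :
    Mono ((homFunctor k X).map f) :=
  fgModuleCat_mono _ ((injective_iff_map_eq_zero _).2 h)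

lemma homFunctor_epi {A B : C} (f : A ⟶ B) (h : ∀ x : X ⟶ B, ∃ y : X ⟶ A, y ≫ f = x) :
    Epi ((homFunctor k X).map f) :=
  fgModuleCat_epi _ h

variable [IsNoetherianRing (End X)ᵐᵒᵖ]

variable (k) in
lemma eq_zero_of_homFunctor_mono {A B : C} (f : A ⟶ B) [Mono ((homFunctor k X).map f)] (x : X ⟶ A)
    (h : x ≫ f = 0) : x = 0 :=
  (injective_iff_map_eq_zero _).1 (fgModuleCat_injective ((homFunctor k X).map f)) x h

variable (k) in
lemma exists_lift_of_homFunctor_epi {A B : C} (f : A ⟶ B) [Epi ((homFunctor k X).map f)]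
    (x : X ⟶ B) : ∃ y : X ⟶ A, y ≫ f = x :=
  fgModuleCat_surjective ((homFunctor k X).map f) x

variable [HasFiniteBiproducts C] [HasBinaryBiproducts C]

omit [IsNoetherianRing (End X)ᵐᵒᵖ] in
/-- The functor `F = Hom(X, -)` is faithful on morphisms from objects of `add X`. -/
lemma eq_zero_of_addClosure {Z A : C} (hZ : addClosure X Z) (f : Z ⟶ A)
    (h : (homFunctor k X).map f = 0) : f = 0 := by
  have : ∀ z : Z ⟶ Z, z ≫ f = 0 := by
    refine addClosure_induction (Q := fun Y => ∀ y : Y ⟶ Z, y ≫ f = 0) ?_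
      ((homFunctor_map_eq_zero_iff f).1 h) hZ
    exact {
      of_isZero := fun _ h _ => h.eq_of_src _ _
      biprod := fun _ _ hA hB y => by
        ext
        · rw [← Category.assoc, hA, comp_zero]
        · rw [← Category.assoc, hB, comp_zero]
      of_retract := fun _ _ r h y => by
        rw [← Category.id_comp y, ← r.retract, Category.assoc, Category.assoc,
          ← Category.assoc r.r, h, comp_zero] }
  simpa using this (𝟙 Z)

omit [IsNoetherianRing (End X)ᵐᵒᵖ] in
lemma comp_eq_zero_of_addClosure {Z A B : C} (hZ : addClosure X Z) (z : Z ⟶ A) (f : A ⟶ B)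
    (h : (homFunctor k X).map f = 0) : z ≫ f = 0 :=
  eq_zero_of_addClosure (k := k) hZ _ (by rw [Functor.map_comp, h, comp_zero])

omit [IsNoetherianRing (End X)ᵐᵒᵖ] in
/-- The functor `F = Hom(X, -)` is full on morphisms from objects of `add X`. -/
lemma exists_map_eq_of_addClosure {Z A : C} (hZ : addClosure X Z)
    (φ : (homFunctor k X).obj Z ⟶ (homFunctor k X).obj A) :
    ∃ f : Z ⟶ A, (homFunctor k X).map f = φ := by
  revert φ
  refine addClosure_induction (Q := fun Z => ∀ φ : (homFunctor k X).obj Z ⟶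
    (homFunctor k X).obj A, ∃ f : Z ⟶ A, (homFunctor k X).map f = φ) ?_ (fun φ => ?_) hZ
  · exact {
      of_isZero := fun _ h φ => ⟨0, (Functor.map_isZero _ h).eq_of_src _ _⟩
      biprod := fun U V hU hV φ => by
        obtain ⟨f, hf⟩ := hU ((homFunctor k X).map biprod.inl ≫ φ)
        obtain ⟨g, hg⟩ := hV ((homFunctor k X).map biprod.inr ≫ φ)
        refine ⟨biprod.desc f g, ?_⟩
        rw [biprod.desc_eq, Functor.map_add, Functor.map_comp, Functor.map_comp, hf, hg,
          ← Category.assoc, ← Category.assoc, ← Preadditive.add_comp, ← Functor.map_comp,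
          ← Functor.map_comp, ← Functor.map_add, biprod.total, CategoryTheory.Functor.map_id,
          Category.id_comp]
      of_retract := fun U V r h φ => by
        obtain ⟨f, hf⟩ := h ((homFunctor k X).map r.r ≫ φ)
        refine ⟨r.i ≫ f, ?_⟩
        rw [Functor.map_comp, hf, ← Category.assoc, ← Functor.map_comp, r.retract,
          CategoryTheory.Functor.map_id, Category.id_comp] }
  · -- A linear map on `Hom(X, X)` is determined by the image of the identity.
    let f : X ⟶ A := φ.hom.hom (𝟙 X)
    refine ⟨f, FGModuleCat.hom_ext (LinearMap.ext fun x => ?_)⟩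
    have := φ.hom.hom.map_smul (MulOpposite.op (show End X from x)) (𝟙 X)
    refine Eq.trans ?_ (this.symm.trans (congrArg φ.hom.hom ?_))
    · rfl
    · exact Category.comp_id x

omit [HasFiniteBiproducts C] [HasBinaryBiproducts C] in
lemma projective_homFunctor_self : Projective ((homFunctor k X).obj X) := by
  rw [fgModuleCat_projective_iff]
  let e : (End X)ᵐᵒᵖ ≃ₗ[(End X)ᵐᵒᵖ] (X ⟶ X) :=
    { MulOpposite.opAddEquiv.symm with map_smul' := fun _ _ => rfl }
  exact Module.Projective.of_equiv e

lemma projective_of_addClosure {Z : C} (hZ : addClosure X Z) :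
    Projective ((homFunctor k X).obj Z) :=
  addClosure_induction (isAddClosed_projective.comap (homFunctor k X))
    projective_homFunctor_self hZ

include k in
variable (k X) in
omit [IsNoetherianRing (End X)ᵐᵒᵖ] [HasBinaryBiproducts C] in
/-- Every object has a right `add X`-approximation. -/
lemma exists_right_approx (A : C) : ∃ (Z : C) (p : Z ⟶ A), addClosure X Z ∧
    ∀ x : X ⟶ A, ∃ y : X ⟶ Z, y ≫ p = x := by
  have : Module.Finite k (X ⟶ A) := HomFinite.finite_hom X A
  obtain ⟨n, s, hs⟩ := Module.Finite.exists_fin (R := k) (M := X ⟶ A)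
  refine ⟨⨁ fun _ : Fin n => X, biproduct.desc s, ⟨n, ⟨Retract.refl _⟩⟩, fun x => ?_⟩
  obtain ⟨c, hc⟩ := (Submodule.mem_span_range_iff_exists_fun k).1
    (hs ▸ Submodule.mem_top : x ∈ Submodule.span k (Set.range s))
  exact ⟨∑ i, c i • biproduct.ι (fun _ : Fin n => X) i, by
    simp [Preadditive.sum_comp, hc]⟩

include k in
variable (k X) in
omit [IsNoetherianRing (End X)ᵐᵒᵖ] [HasBinaryBiproducts C] in
/-- Every object has a left `add X`-approximation. -/
lemma exists_left_approx (A : C) : ∃ (Z : C) (q : A ⟶ Z), addClosure X Z ∧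
    ∀ x : A ⟶ X, ∃ y : Z ⟶ X, q ≫ y = x := by
  have : Module.Finite k (A ⟶ X) := HomFinite.finite_hom A X
  obtain ⟨n, s, hs⟩ := Module.Finite.exists_fin (R := k) (M := A ⟶ X)
  refine ⟨⨁ fun _ : Fin n => X, biproduct.lift s, ⟨n, ⟨Retract.refl _⟩⟩, fun x => ?_⟩
  obtain ⟨c, hc⟩ := (Submodule.mem_span_range_iff_exists_fun k).1
    (hs ▸ Submodule.mem_top : x ∈ Submodule.span k (Set.range s))
  exact ⟨∑ i, c i • biproduct.π (fun _ : Fin n => X) i, by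
    simp [Preadditive.comp_sum, hc]⟩

omit [IsNoetherianRing (End X)ᵐᵒᵖ] [HasBinaryBiproducts C] in
/-- Every finitely generated module is a quotient of `F Z` for some `Z` in `add X`. -/
lemma exists_epi_of_addClosure (M : FGModuleCat.{v} (End X)ᵐᵒᵖ) :
    ∃ (Z : C) (π : (homFunctor k X).obj Z ⟶ M), addClosure X Z ∧ Epi π := by
  obtain ⟨n, s, hs⟩ := Module.Finite.exists_fin (R := (End X)ᵐᵒᵖ) (M := M)
  let F := homFunctor k X
  have := finite_hom_over_end k X X
  let t (i : Fin n) : F.obj X ⟶ M := FGModuleCat.ofHom (V := X ⟶ X)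
    { toFun := fun x => MulOpposite.op (show End X from x) • s i
      map_add' := fun x y => add_smul (MulOpposite.op (show End X from x))
        (MulOpposite.op (show End X from y)) (s i)
      map_smul' := fun a x => mul_smul a (MulOpposite.op (show End X from x)) (s i) }
  let π : F.obj (⨁ fun _ : Fin n => X) ⟶ M :=
    ∑ i, F.map (biproduct.π (fun _ : Fin n => X) i) ≫ t i
  have hπ : ∀ i, F.map (biproduct.ι (fun _ : Fin n => X) i) ≫ π = t i := fun i => by
    rw [Preadditive.comp_sum, Finset.sum_eq_single i]
    · rw [← Category.assoc, ← Functor.map_comp, biproduct.ι_π_self, CategoryTheory.Functor.map_id,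
        Category.id_comp]
    · intro j _ hj
      rw [← Category.assoc, ← Functor.map_comp, biproduct.ι_π_ne _ hj.symm, Functor.map_zero,
        zero_comp]
    · simp
  refine ⟨_, π, ⟨n, ⟨Retract.refl _⟩⟩, fgModuleCat_epi _ ?_⟩
  rw [← LinearMap.range_eq_top, eq_top_iff, ← hs, Submodule.span_le]
  rintro _ ⟨i, rfl⟩
  refine ⟨(F.map (biproduct.ι (fun _ : Fin n => X) i)).hom.hom (𝟙 X), ?_⟩
  refine (LinearMap.congr_fun (congrArg (fun g => g.hom.hom) (hπ i)) (𝟙 X)).trans ?_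
  exact one_smul (End X)ᵐᵒᵖ (s i)

omit [IsNoetherianRing (End X)ᵐᵒᵖ] in
/-- Every finitely generated projective module is of the form `F Z` with `Z` in `add X`. -/
lemma exists_iso_of_projective [IsIdempotentComplete C] (P : FGModuleCat.{v} (End X)ᵐᵒᵖ)
    [Projective P] : ∃ Z : C, addClosure X Z ∧ Nonempty ((homFunctor k X).obj Z ≅ P) := by
  obtain ⟨Z, π, hZ, _⟩ := exists_epi_of_addClosure (k := k) P
  let F := homFunctor k X
  let s : P ⟶ F.obj Z := Projective.factorThru (𝟙 _) π
  have hs : s ≫ π = 𝟙 _ := Projective.factorThru_comp _ _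
  obtain ⟨e, he⟩ := exists_map_eq_of_addClosure hZ (π ≫ s)
  have hee : e ≫ e = e := by
    rw [← sub_eq_zero]
    apply eq_zero_of_addClosure (k := k) hZ
    rw [Functor.map_sub, Functor.map_comp, he, Category.assoc, reassoc_of% hs, sub_self]
  obtain ⟨Y, i, r, hir, hri⟩ := IsIdempotentComplete.idempotents_split Z e hee
  refine ⟨Y, (isAddClosed_addClosure X).of_retract _ _ ⟨i, r, hir⟩ hZ,
    ⟨⟨F.map i ≫ π, s ≫ F.map r, ?_, ?_⟩⟩⟩
  · rw [Category.assoc, ← reassoc_of% he, ← Functor.map_comp,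
      ← Functor.map_comp, ← hri]
    simp [hir, F]
  · rw [Category.assoc, ← Functor.map_comp_assoc, hri, he, Category.assoc, hs, Category.comp_id, hs]

omit [IsNoetherianRing (End X)ᵐᵒᵖ] in
/-- If `F B` is projective, then an isomorphism from some `F Z`, `Z` in `add X`, to `F B` is induced
by a morphism `Z ⟶ B`. -/
lemma exists_isIso_of_projective [IsIdempotentComplete C] (B : C)
    (hB : Projective ((homFunctor k X).obj B)) :
    ∃ (Z : C) (j : Z ⟶ B), addClosure X Z ∧ IsIso ((homFunctor k X).map j) := by
  obtain ⟨Z, hZ, ⟨e⟩⟩ := exists_iso_of_projective (k := k) ((homFunctor k X).obj B)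
  obtain ⟨j, hj⟩ := exists_map_eq_of_addClosure hZ e.hom
  exact ⟨Z, j, hZ, hj ▸ inferInstance⟩

end HomFunctor

/-! ### Approximation triangles of cluster tilting objects -/

section Tilting

open Pretriangulated

variable {k : Type v} [Field k] {C : Type u} [Category.{v} C] [Preadditive C] [Linear k C]
  [HomFinite k C] [HasZeroObject C] [HasShift C ℤ] [∀ n : ℤ, (shiftFunctor C n).Additive]
  [Pretriangulated C]

section Triangles

omit [Linear k C] [HomFinite k C]

variable {K Z A : C} {κ : K ⟶ Z} {p : Z ⟶ A} {δ : A ⟶ K⟦(1 : ℤ)⟧}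
  (hT : Triangle.mk κ p δ ∈ distTriang C)

include hT

lemma dist_comp₁₂ : κ ≫ p = 0 := comp_distTriang_mor_zero₁₂ _ hT

lemma dist_comp₂₃ : p ≫ δ = 0 := comp_distTriang_mor_zero₂₃ _ hT

lemma dist_comp₃₁ : δ ≫ κ⟦(1 : ℤ)⟧' = 0 := comp_distTriang_mor_zero₃₁ _ hT

lemma dist_lift₁ {B : C} (x : B ⟶ K⟦(1 : ℤ)⟧) (hx : x ≫ κ⟦(1 : ℤ)⟧' = 0) :
    ∃ y : B ⟶ A, y ≫ δ = x := by
  obtain ⟨y, hy⟩ := Triangle.coyoneda_exact₁ _ hT x hx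
  exact ⟨y, hy.symm⟩

lemma dist_lift₂ {B : C} (x : B ⟶ Z) (hx : x ≫ p = 0) : ∃ y : B ⟶ K, y ≫ κ = x := by
  obtain ⟨y, hy⟩ := Triangle.coyoneda_exact₂ _ hT x hx
  exact ⟨y, hy.symm⟩

lemma dist_lift₃ {B : C} (x : B ⟶ A) (hx : x ≫ δ = 0) : ∃ y : B ⟶ Z, y ≫ p = x := by
  obtain ⟨y, hy⟩ := Triangle.coyoneda_exact₃ _ hT x hx
  exact ⟨y, hy.symm⟩

lemma dist_desc₂ {B : C} (x : Z ⟶ B) (hx : κ ≫ x = 0) : ∃ y : A ⟶ B, p ≫ y = x := by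
  obtain ⟨y, hy⟩ := Triangle.yoneda_exact₂ _ hT x hx
  exact ⟨y, hy.symm⟩

lemma dist_desc₃ {B : C} (x : A ⟶ B) (hx : p ≫ x = 0) :
    ∃ y : K⟦(1 : ℤ)⟧ ⟶ B, δ ≫ y = x := by
  obtain ⟨y, hy⟩ := Triangle.yoneda_exact₃ _ hT x hx
  exact ⟨y, hy.symm⟩

end Triangles

/-- `T` is `d`-cluster tilting and `add X` is the additive closure of
`T, T[-1], …, T[-(d-2)]`. -/
structure IsTiltingPair (d : ℤ) (T X : C) : Prop where
  two_le : 2 ≤ d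
  tilting : IsClusterTilting d T
  add_iff : ∀ A, addClosure X A ↔ shiftAdd T (2 - d) 0 A

namespace IsTiltingPair

variable {d : ℤ} {T X : C}

lemma self_hom_zero (h : IsTiltingPair d T X) (i : ℤ) (h₀ : 0 < i) (h₁ : i < d)
    (f : T ⟶ T⟦i⟧) : f = 0 :=
  (h.tilting.add_iff_right T).1 (addClosure_self T) i h₀ h₁ f

/-- `Hom(T[i], T[j]) = 0` for `0 < j - i < d`. -/
lemma shift_hom_zero (h : IsTiltingPair d T X) (i j : ℤ) (h₀ : i < j) (h₁ : j < i + d)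
    (f : T⟦i⟧ ⟶ T⟦j⟧) : f = 0 := by
  obtain ⟨g, hg⟩ := (shiftFunctor C i).map_surjective
    (f ≫ (shiftFunctorAdd' C (j - i) i j (by lia)).hom.app T)
  rw [h.self_hom_zero (j - i) (by lia) (by lia) g, Functor.map_zero] at hg
  rw [← cancel_mono ((shiftFunctorAdd' C (j - i) i j (by lia)).hom.app T), ← hg, zero_comp]

/-- There are no nonzero morphisms from sums of `T[i]`, `a ≤ i ≤ b`, to sums of `T[j]`,
`a' ≤ j ≤ b'`, if `0 < j - i < d` for all these `i` and `j`. -/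
lemma hom_zero (h : IsTiltingPair d T X) {a b a' b' : ℤ} (h₀ : b < a') (h₁ : b' < a + d)
    {A B : C} (hA : shiftAdd T a b A) (hB : shiftAdd T a' b' B) (f : A ⟶ B) : f = 0 := by
  revert f
  refine hA _ (isAddClosed_hom_from_zero B) fun i hi hi' => ?_
  refine hB _ (isAddClosed_hom_to_zero _) fun j hj hj' => ?_
  exact h.shift_hom_zero i j (by lia) (by lia)

lemma comp_eq_zero (h : IsTiltingPair d T X) {Z A B : C} (hZ : shiftAdd T (2 - d) 0 Z)
    (f : A ⟶ B) (hf : (homFunctor k X).map f = 0) (z : Z ⟶ A) : z ≫ f = 0 :=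
  comp_eq_zero_of_addClosure ((h.add_iff Z).2 hZ) z f hf

/-- An object `A` without nonzero morphisms from `X[n]` belongs to `add T[n+1]`. -/
lemma shiftAdd_of_hom_zero (h : IsTiltingPair d T X) (n : ℤ) {A : C}
    (hA : ∀ j : ℤ, n + 2 - d ≤ j → j ≤ n → ∀ f : T⟦j⟧ ⟶ A, f = 0) :
    shiftAdd T (n + 1) (n + 1) A := by
  have hm : shiftAdd T 0 0 (A⟦-(n + 1)⟧) := by
    rw [← addClosure_iff_shiftAdd_zero, h.tilting.add_iff_right]
    intro i hi hi' f
    let e := (shiftFunctorAdd' C (-(n + 1)) i (i - (n + 1)) (by lia)).symm.app A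
    obtain ⟨g, hg⟩ := exists_unshift (i - (n + 1)) (n + 1 - i) (by lia) (f ≫ e.hom)
    rw [hA (n + 1 - i) (by lia) (by lia) g, Functor.map_zero, comp_zero] at hg
    rw [← cancel_mono e.hom, hg, zero_comp]
  exact (isAddClosed_shiftAdd T _ _).of_retract _ _
    (Retract.ofIso ((shiftFunctorCompIsoId C (-(n + 1)) (n + 1) (by lia)).symm.app A))
    (shiftAdd_shift (n + 1) (by lia) (by lia) hm)

variable [IsNoetherianRing (End X)ᵐᵒᵖ]

/-- `F T[1] = 0`, and `F T[j]` is projective for `-(d-2) ≤ j ≤ 0`. -/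
lemma projective (h : IsTiltingPair d T X) {A : C} (hA : shiftAdd T (2 - d) 1 A) :
    Projective ((homFunctor k X).obj A) := by
  have := h.two_le
  refine hA _ (isAddClosed_projective.comap (homFunctor k X)) fun j h₁ h₂ => ?_
  rcases eq_or_lt_of_le h₂ with rfl | h₃
  · refine (homFunctor_obj_isZero_iff.2 fun x => ?_).projective
    exact h.hom_zero (by lia) (by lia) ((h.add_iff X).1 (addClosure_self X))
      (shiftAdd_shift_self le_rfl le_rfl) x
  · exact projective_of_addClosure ((h.add_iff _).2 (shiftAdd_shift_self h₁ (by lia)))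

omit [IsNoetherianRing (End X)ᵐᵒᵖ] in
/-- If `F j` is a monomorphism and `Z` belongs to `add X`, then composition with `j[1]` is
injective on morphisms from `X` to `Z[1]`. -/
lemma eq_zero_of_comp_shift_eq_zero (h : IsTiltingPair d T X) {Z B : C} (j : Z ⟶ B)
    (hZ : shiftAdd T (2 - d) 0 Z) [Mono ((homFunctor k X).map j)] (x : X ⟶ Z⟦(1 : ℤ)⟧)
    (hx : x ≫ j⟦(1 : ℤ)⟧' = 0) : x = 0 := by
  have := h.two_le
  revert x
  refine (h.add_iff X).1 (addClosure_self X) _ (isAddClosed_injective_comp _) fun i h₁ h₂ => ?_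
  rcases eq_or_lt_of_le h₁ with rfl | h₃
  · intro x _
    exact h.hom_zero (by lia) (by lia) (shiftAdd_shift_self le_rfl le_rfl)
      (shiftAdd_shift (a' := 3 - d) (b' := 1) 1 (by lia) (by lia) hZ) x
  · refine injective_comp_shift j 1 (-1) (by lia) fun z hz => ?_
    have hz' : shiftAdd T (2 - d) 0 (T⟦i⟧⟦(-1 : ℤ)⟧) :=
      shiftAdd_mono (by lia) (by lia)
        (shiftAdd_shift (a' := i - 1) (b' := i - 1) (-1) (by lia) (by lia)
          (shiftAdd_shift_self (le_refl i) (le_refl i)))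
    apply eq_zero_of_addClosure (k := k) ((h.add_iff _).2 hz')
    rw [← cancel_mono ((homFunctor k X).map j), ← Functor.map_comp, hz, Functor.map_zero,
      zero_comp]

variable [IsIdempotentComplete C]

/-- The objects whose image under `F` is projective belong to `add (X ⊞ T[1])`. -/
lemma shiftAdd_of_projective (h : IsTiltingPair d T X) (B : C)
    (hB : Projective ((homFunctor k X).obj B)) : shiftAdd T (2 - d) 1 B := by
  have := h.two_le
  obtain ⟨Z, j, hZ, hj⟩ := exists_isIso_of_projective (k := k) B hB
  rw [h.add_iff] at hZ
  obtain ⟨V, v, w, hT⟩ := distinguished_cocone_triangle j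
  -- There are no nonzero morphisms from `X` to the cone `V`, hence `V` belongs to `add T[1]`.
  have hV : shiftAdd T 1 1 V := by
    refine h.shiftAdd_of_hom_zero 0 fun i h₁ h₂ x => ?_
    have hi : shiftAdd T (2 - d) 0 (T⟦i⟧) := shiftAdd_shift_self (by lia) (by lia)
    have hxz : ∀ x : X ⟶ V, x = 0 := fun x => by
      have hw : x ≫ w = 0 := h.eq_zero_of_comp_shift_eq_zero (k := k) j hZ _ (by
        rw [Category.assoc, dist_comp₃₁ hT,
          comp_zero])
      obtain ⟨y, rfl⟩ := dist_lift₃ hT x hw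
      obtain ⟨y, rfl⟩ := exists_lift_of_homFunctor_epi k j y
      rw [Category.assoc, dist_comp₁₂ hT, comp_zero]
    exact addClosure_induction (isAddClosed_hom_from_zero V) hxz ((h.add_iff _).2 hi) x
  -- The connecting morphism vanishes, so `B` is the direct sum of `Z` and `V`.
  have hw : w = 0 := by
    refine injective_comp_shift j 1 (-1) (by lia) (fun z hz => ?_) w
      (dist_comp₃₁ hT)
    have hz' : shiftAdd T (2 - d) 0 (V⟦(-1 : ℤ)⟧) :=
      shiftAdd_mono (by lia) (by lia) (shiftAdd_shift (a' := 0) (b' := 0) (-1) (by lia) (by lia) hV)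
    apply eq_zero_of_addClosure (k := k) ((h.add_iff _).2 hz')
    rw [← cancel_mono ((homFunctor k X).map j), ← Functor.map_comp, hz, Functor.map_zero,
      zero_comp]
  obtain ⟨e, -, -⟩ := exists_iso_binaryBiproduct_of_distTriang _ hT hw
  have hadd := isAddClosed_shiftAdd T (2 - d) 1
  exact hadd.of_retract _ _ (Retract.ofIso e)
    (hadd.biprod _ _ (shiftAdd_mono le_rfl (by lia) hZ) (shiftAdd_mono (by lia) le_rfl hV))

/-- Submodules of finitely generated projective modules are projective. This is the form in which
the endomorphism ring of `X` being hereditary enters. -/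
abbrev SubProjective (R : Type v) [Ring R] : Prop :=
  ∀ (M N : FGModuleCat.{v} R) (f : M ⟶ N) [Mono f], Projective N → Projective M

include k in
/-- For the triangle `K ⟶ Z ⟶ A ⟶ K[1]` of a right `add X`-approximation of `A`, the module
`F K[1]` is projective as a submodule of `F Z[1]`, so `K[1]` belongs to `add (X ⊞ T[1])`. -/
lemma cone_approx (h : IsTiltingPair d T X) (hs : SubProjective (End X)ᵐᵒᵖ) {K Z A : C}
    {κ : K ⟶ Z} {p : Z ⟶ A} {δ : A ⟶ K⟦(1 : ℤ)⟧} (hT : Triangle.mk κ p δ ∈ distTriang C)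
    (hZ : shiftAdd T (2 - d) 0 Z) (hp : ∀ x : X ⟶ A, ∃ y : X ⟶ Z, y ≫ p = x) :
    shiftAdd T (2 - d) 1 (K⟦(1 : ℤ)⟧) := by
  apply h.shiftAdd_of_projective (k := k)
  have hm : Mono ((homFunctor k X).map (κ⟦(1 : ℤ)⟧')) := homFunctor_mono _ fun x hx => by
    obtain ⟨y, rfl⟩ := dist_lift₁ hT x hx
    obtain ⟨z, rfl⟩ := hp y
    rw [Category.assoc, dist_comp₂₃ hT, comp_zero]
  exact hs _ _ ((homFunctor k X).map (κ⟦(1 : ℤ)⟧')) (h.projective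
    (shiftAdd_mono (a := 3 - d) (b := 1) (by lia) (by lia)
      (shiftAdd_shift 1 (by lia) (by lia) hZ)))

include k in
lemma fibre_approx (h : IsTiltingPair d T X) (hs : SubProjective (End X)ᵐᵒᵖ) {K Z A : C}
    {κ : K ⟶ Z} {p : Z ⟶ A} {δ : A ⟶ K⟦(1 : ℤ)⟧} (hT : Triangle.mk κ p δ ∈ distTriang C)
    (hZ : shiftAdd T (2 - d) 0 Z) (hp : ∀ x : X ⟶ A, ∃ y : X ⟶ Z, y ≫ p = x) :
    shiftAdd T (1 - d) 0 K :=
  (isAddClosed_shiftAdd T _ _).of_retract _ _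
    (Retract.ofIso ((shiftFunctorCompIsoId C 1 (-1) (by lia)).symm.app K))
    (shiftAdd_shift (-1) (by lia) (by lia) (h.cone_approx (k := k) hs hT hZ hp))

include k in
variable (k) in
omit [IsNoetherianRing (End X)ᵐᵒᵖ] [IsIdempotentComplete C] in
lemma exists_approx_triangle (h : IsTiltingPair d T X) (A : C) :
    ∃ (K Z : C) (κ : K ⟶ Z) (p : Z ⟶ A) (δ : A ⟶ K⟦(1 : ℤ)⟧),
      Triangle.mk κ p δ ∈ distTriang C ∧ shiftAdd T (2 - d) 0 Z ∧
      ∀ x : X ⟶ A, ∃ y : X ⟶ Z, y ≫ p = x := by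
  obtain ⟨Z, p, hZ, hp⟩ := exists_right_approx k X A
  obtain ⟨K, κ, δ, hT⟩ := distinguished_cocone_triangle₁ p
  exact ⟨K, Z, κ, p, δ, hT, (h.add_iff _).1 hZ, hp⟩

/-- Morphisms killed by `F` factor through `add (X ⊞ T[1])`, because they vanish on a right
`add X`-approximation. -/
lemma factorsThru_of_map_eq_zero (h : IsTiltingPair d T X) (hs : SubProjective (End X)ᵐᵒᵖ)
    {A B : C} (f : A ⟶ B) (hf : (homFunctor k X).map f = 0) :
    FactorsThru (shiftAdd T (2 - d) 1) f := by
  obtain ⟨K, Z, κ, p, δ, hT, hZ, hp⟩ := h.exists_approx_triangle k A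
  obtain ⟨g, hg⟩ := dist_desc₃ hT f (h.comp_eq_zero hZ f hf p)
  exact ⟨_, h.cone_approx (k := k) hs hT hZ hp, δ, g, hg⟩

omit [IsNoetherianRing (End X)ᵐᵒᵖ] [IsIdempotentComplete C] in
/-- The functor `F` detects the vanishing of morphisms from sums of `T[j]`, `-(d-1) ≤ j ≤ 0`,
that factor through `add X`. This uses `Hom(T[-(d-1)], X) = 0`. -/
lemma comp_eq_zero_of_map_eq_zero (h : IsTiltingPair d T X) {K Z B : C}
    (hK : shiftAdd T (1 - d) 0 K) (hZ : shiftAdd T (2 - d) 0 Z) (κ : K ⟶ Z) (b : Z ⟶ B)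
    (hb : (homFunctor k X).map (κ ≫ b) = 0) : κ ≫ b = 0 := by
  revert κ
  refine hK (fun K => ∀ κ : K ⟶ Z, (homFunctor k X).map (κ ≫ b) = 0 → κ ≫ b = 0) ?_ ?_
  · exact {
      of_isZero := fun _ h _ _ => h.eq_of_src _ _
      biprod := fun U V hU hV κ hκ => by
        rw [homFunctor_map_eq_zero_iff] at hκ
        ext
        · rw [← Category.assoc, comp_zero]
          refine hU _ ((homFunctor_map_eq_zero_iff _).2 fun x => ?_)
          rw [Category.assoc, ← Category.assoc, hκ]
        · rw [← Category.assoc, comp_zero]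
          refine hV _ ((homFunctor_map_eq_zero_iff _).2 fun x => ?_)
          rw [Category.assoc, ← Category.assoc, hκ]
      of_retract := fun U V r hV κ hκ => by
        have := hV (r.r ≫ κ) (by rw [Category.assoc, Functor.map_comp, hκ, comp_zero])
        rw [← Category.id_comp κ, ← r.retract, Category.assoc, Category.assoc,
          ← Category.assoc r.r, this, comp_zero] }
  · intro j h₁ h₂ κ hκ
    have := h.two_le
    rcases eq_or_lt_of_le h₁ with rfl | h₃
    · rw [h.hom_zero (by lia) (by lia) (shiftAdd_shift_self le_rfl le_rfl) hZ κ, zero_comp]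
    · exact eq_zero_of_addClosure (k := k)
        ((h.add_iff _).2 (shiftAdd_shift_self (by lia) h₂)) _ hκ

/-- The functor `F` is full: a morphism `F A ⟶ F B` lifts to a right `add X`-approximation of `A`
and then descends along its triangle. -/
lemma full (h : IsTiltingPair d T X) (hs : SubProjective (End X)ᵐᵒᵖ) :
    (homFunctor k X).Full where
  map_surjective {A B} φ := by
    obtain ⟨K, Z, κ, p, δ, hT, hZ, hp⟩ := h.exists_approx_triangle k A
    obtain ⟨b, hb⟩ := exists_map_eq_of_addClosure ((h.add_iff Z).2 hZ)
      ((homFunctor k X).map p ≫ φ)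
    have h0 : κ ≫ b = 0 := h.comp_eq_zero_of_map_eq_zero (k := k)
      (h.fibre_approx (k := k) hs hT hZ hp) hZ κ b (by
        rw [Functor.map_comp, hb, ← Category.assoc, ← Functor.map_comp,
          dist_comp₁₂ hT, Functor.map_zero, zero_comp])
    obtain ⟨f, hf⟩ := dist_desc₂ hT b h0
    have := homFunctor_epi (k := k) p hp
    refine ⟨f, ?_⟩
    rw [← cancel_epi ((homFunctor k X).map p), ← hb, ← Functor.map_comp, hf]

end IsTiltingPair

end Tilting

/-! ### The functor `Hom(X, -)` is dense -/

section Density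

open Pretriangulated

variable {k : Type v} [Field k] {C : Type u} [Category.{v} C] [Preadditive C] [Linear k C]
  [HomFinite k C] [HasZeroObject C] [HasShift C ℤ] [∀ n : ℤ, (shiftFunctor C n).Additive]
  [Pretriangulated C] [IsIdempotentComplete C]
  {d : ℤ} {T X : C} [IsNoetherianRing (End X)ᵐᵒᵖ]

namespace IsTiltingPair

/-- A projective quotient of `F A` is the image of a summand of `A` that belongs to `add X`. -/
lemma exists_split_of_epi (h : IsTiltingPair d T X) (hs : SubProjective (End X)ᵐᵒᵖ) {A : C}
    {P : FGModuleCat.{v} (End X)ᵐᵒᵖ} [Projective P] (q : (homFunctor k X).obj A ⟶ P) [Epi q] :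
    ∃ (Y : C) (β : (homFunctor k X).obj Y ≅ P) (ρ : A ⟶ Y) (σ : Y ⟶ A), addClosure X Y ∧
      σ ≫ ρ = 𝟙 Y ∧ (homFunctor k X).map ρ ≫ β.hom = q := by
  have hfull := h.full (k := k) hs
  obtain ⟨Y, hY, ⟨β⟩⟩ := exists_iso_of_projective (k := k) P
  obtain ⟨ρ, hρ⟩ := (homFunctor k X).map_surjective (q ≫ β.inv)
  obtain ⟨σ, hσ⟩ := (homFunctor k X).map_surjective (β.hom ≫ Projective.factorThru (𝟙 P) q)
  refine ⟨Y, β, ρ, σ, hY, ?_, by rw [hρ, Category.assoc, β.inv_hom_id, Category.comp_id]⟩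
  rw [← sub_eq_zero]
  apply eq_zero_of_addClosure (k := k) hY
  rw [Functor.map_sub, Functor.map_comp, hσ, hρ, Category.assoc,
    Projective.factorThru_comp_assoc, Category.id_comp, β.hom_inv_id,
    CategoryTheory.Functor.map_id, sub_self]

/-- Every module `M` is of the form `F A`. For the cone `E` of a morphism of `add X` that lifts
a projective resolution of `M`, the module `F E` is the direct sum of `M` and a projective module,
and the projective summand is split off `E` by fullness. -/
lemma dense (h : IsTiltingPair d T X) (hs : SubProjective (End X)ᵐᵒᵖ)
    (M : FGModuleCat.{v} (End X)ᵐᵒᵖ) : ∃ A : C, Nonempty ((homFunctor k X).obj A ≅ M) := by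
  let F := homFunctor k X
  have hfull : F.Full := h.full (k := k) hs
  obtain ⟨X₀, π, hX₀, _⟩ := exists_epi_of_addClosure (k := k) M
  have := hs _ _ (kernel.ι π) (projective_of_addClosure hX₀)
  obtain ⟨X₁, hX₁, ⟨α⟩⟩ := exists_iso_of_projective (k := k) (kernel π)
  obtain ⟨u, hu⟩ := exists_map_eq_of_addClosure hX₁ (α.hom ≫ kernel.ι π)
  obtain ⟨E, c, w, hT⟩ := distinguished_cocone_triangle u
  have hu0 : F.map u ≫ π = 0 := by rw [hu, Category.assoc, kernel.condition, comp_zero]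
  have hk : kernel.ι π = α.inv ≫ F.map u := by rw [hu, α.inv_hom_id_assoc]
  -- The image `Q` of `F w` is projective.
  let Q := image (F.map w)
  have hQ : Projective Q := hs _ _ (image.ι (F.map w)) (h.projective
    (shiftAdd_mono (a := 3 - d) (b := 1) (by lia) (by lia)
      (shiftAdd_shift 1 (by lia) (by lia) ((h.add_iff _).1 hX₁))))
  obtain ⟨Y, β, ρ, σ, hY, hσρ, hρ⟩ := h.exists_split_of_epi hs (factorThruImage (F.map w))
  have hw : ∀ {B : C} (f : B ⟶ E), F.map (f ≫ w) = 0 ↔ F.map (f ≫ ρ) = 0 := fun f => by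
    have e : F.map (f ≫ w) = F.map (f ≫ ρ) ≫ β.hom ≫ image.ι (F.map w) := by
      rw [Functor.map_comp, Functor.map_comp, Category.assoc, reassoc_of% hρ, image.fac]
    rw [e, ← cancel_mono (β.hom ≫ image.ι (F.map w)), zero_comp]
  obtain ⟨A, i, p, hip, hpi⟩ := exists_complement (⟨σ, ρ, hσρ⟩ : Retract Y E)
  dsimp only at hpi
  let θ : M ⟶ F.obj A := Abelian.epiDesc π (F.map (c ≫ p)) (by
    rw [hk, Category.assoc, ← Functor.map_comp, ← Category.assoc, dist_comp₁₂ hT, zero_comp,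
      Functor.map_zero, comp_zero])
  have hθ : π ≫ θ = F.map (c ≫ p) := Abelian.comp_epiDesc _ _ _
  have hiρ : i ≫ ρ = 0 := by
    have : p ≫ i ≫ ρ = 0 := by
      rw [← Category.assoc, hpi, Preadditive.sub_comp, Category.assoc, hσρ]; simp
    simpa [reassoc_of% hip] using i ≫= this
  have h₁ : Epi θ := by
    have : Epi (π ≫ θ) := by
      rw [hθ]
      refine homFunctor_epi _ fun y => ?_
      have hy : (y ≫ i) ≫ w = 0 := by
        rw [Category.assoc]
        refine (homFunctor_map_eq_zero_iff (k := k) _).1 ?_ y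
        rw [hw, hiρ, Functor.map_zero]
      obtain ⟨x, hx⟩ := dist_lift₃ hT _ hy
      exact ⟨x, by rw [← Category.assoc, hx, Category.assoc, hip, Category.comp_id]⟩
    exact epi_of_epi π θ
  have h₂ : Mono θ := by
    refine fgModuleCat_mono _ ((injective_iff_map_eq_zero _).2 fun z hz => ?_)
    obtain ⟨x, rfl⟩ := fgModuleCat_surjective π z
    change X ⟶ X₀ at x
    have hx : x ≫ c ≫ p = 0 :=
      (LinearMap.congr_fun (congrArg (fun g => g.hom.hom) hθ) x).symm.trans hz
    have hcρ : x ≫ c ≫ ρ = 0 := by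
      refine (homFunctor_map_eq_zero_iff (k := k) _).1 ?_ x
      rw [← hw, dist_comp₂₃ hT, Functor.map_zero]
    have hxc : x ≫ c = 0 := by
      have := hx =≫ i
      rw [Category.assoc, Category.assoc, hpi, zero_comp] at this
      simpa [Preadditive.comp_sub, reassoc_of% hcρ] using this
    obtain ⟨y, rfl⟩ := dist_lift₂ hT x hxc
    exact LinearMap.congr_fun (congrArg (fun g => g.hom.hom) hu0) y
  have := isIso_of_mono_of_epi θ
  exact ⟨A, ⟨(asIso θ).symm⟩⟩

end IsTiltingPair

end Density

/-! ### Calabi-Yau duality and injective modules -/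

section Duality

open Pretriangulated

variable {k : Type v} [Field k] {C : Type u} [Category.{v} C] [Preadditive C] [Linear k C]
  [HomFinite k C] [HasShift C ℤ] {d : ℤ}

/-- The isomorphisms `Hom(A, B) ≅ D Hom(B, A[d])` of a `d`-Calabi-Yau category. -/
def cyDuality (hCY : IsCalabiYau k C d) (A B : C) : (A ⟶ B) ≃ₗ[k] Module.Dual k (B ⟶ A⟦d⟧) :=
  hCY.exists_duality.choose A B

section

variable (hCY : IsCalabiYau k C d)

lemma cyDuality_comp_left {A A' B : C} (a : A' ⟶ A) (f : A ⟶ B) (g : B ⟶ A'⟦d⟧) :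
    cyDuality hCY A' B (a ≫ f) g = cyDuality hCY A B f (g ≫ a⟦d⟧') := by
  have := hCY.exists_duality.choose_spec A A' B B a f (𝟙 B) g
  rwa [Category.comp_id, Category.id_comp] at this

lemma cyDuality_comp_right {A B B' : C} (f : A ⟶ B) (b : B ⟶ B') (g : B' ⟶ A⟦d⟧) :
    cyDuality hCY A B' (f ≫ b) g = cyDuality hCY A B f (b ≫ g) := by
  have := hCY.exists_duality.choose_spec A A B B' (𝟙 A) f b g
  rwa [Category.id_comp, CategoryTheory.Functor.map_id, Category.comp_id] at this

lemma cyDuality_eq {A B : C} (f : A ⟶ B) (g : B ⟶ A⟦d⟧) :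
    cyDuality hCY A B f g = cyDuality hCY A _ (f ≫ g) (𝟙 _) := by
  rw [cyDuality_comp_right, Category.comp_id]

include hCY in
/-- The functor `F = Hom(X, -)` is faithful on morphisms to `X[d]`: the composition
pairing of `Hom(X, A)` with `Hom(A, X[d])` is perfect. -/
lemma eq_zero_of_forall_comp_eq_zero {X A : C} (g : A ⟶ X⟦d⟧) (hg : ∀ x : X ⟶ A, x ≫ g = 0) :
    g = 0 := by
  rw [← Module.forall_dual_apply_eq_zero_iff k]
  intro l
  obtain ⟨x, rfl⟩ := (cyDuality hCY X A).surjective l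
  rw [cyDuality_eq, hg x, map_zero, LinearMap.zero_apply]

include hCY in
/-- Morphisms from `X` are separated by the morphisms to `X[d]`. -/
lemma eq_zero_of_forall_comp_shift_eq_zero {X A : C} (x : X ⟶ A)
    (hx : ∀ g : A ⟶ X⟦d⟧, x ≫ g = 0) : x = 0 := by
  apply (cyDuality hCY X A).injective
  rw [map_zero]
  ext g
  rw [cyDuality_eq, hx g, map_zero]
  rfl

/-- Linear forms on `Hom(X, A)` are represented by morphisms `A ⟶ X[d]`. -/
lemma exists_cyDuality_eq {X A : C} (l : Module.Dual k (X ⟶ A)) :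
    ∃ g : A ⟶ X⟦d⟧, ∀ x : X ⟶ A, cyDuality hCY X A x g = l x := by
  have : Module.Finite k (A ⟶ X⟦d⟧) := HomFinite.finite_hom _ _
  refine ⟨(Module.evalEquiv k (A ⟶ X⟦d⟧)).symm
    (l.comp (cyDuality hCY X A).symm.toLinearMap), fun x => ?_⟩
  rw [← Module.Dual.eval_apply k, ← Module.evalEquiv_toLinearMap]
  simp

end

variable [HasZeroObject C] [∀ n : ℤ, (shiftFunctor C n).Additive]
  [Pretriangulated C] [IsIdempotentComplete C] {T X : C} [IsNoetherianRing (End X)ᵐᵒᵖ]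

namespace IsTiltingPair

omit [Linear k C] [HomFinite k C] [IsIdempotentComplete C] [IsNoetherianRing (End X)ᵐᵒᵖ] in
lemma addClosure_shift_iff (h : IsTiltingPair d T X) (A : C) :
    addClosure (X⟦d⟧) A ↔ shiftAdd T 2 d A := by
  refine addClosure_iff_shiftAdd
    (shiftAdd_shift d (by lia) (by lia) ((h.add_iff X).1 (addClosure_self X))) (fun j h₁ h₂ => ?_) A
  refine (isAddClosed_addClosure _).of_retract _ _
    (Retract.ofIso ((shiftFunctorAdd' C (j - d) d j (by lia)).app T)) ?_
  exact addClosure_induction ((isAddClosed_addClosure (X⟦d⟧)).comap (shiftFunctor C d))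
    (addClosure_self _) ((h.add_iff (T⟦j - d⟧)).2 (shiftAdd_shift_self (by lia) (by lia)))

/-- The module `F X[d]` is injective, as it is dual to the regular module: linear forms on
`Hom(X, A)` extend along injections `Hom(X, A) ⟶ Hom(X, B)`. -/
lemma injective_shift (h : IsTiltingPair d T X) (hs : SubProjective (End X)ᵐᵒᵖ)
    (hCY : IsCalabiYau k C d) : Injective ((homFunctor k X).obj (X⟦d⟧)) where
  factors {M N} g j _ := by
    let F := homFunctor k X
    have hfull : F.Full := h.full (k := k) hs
    obtain ⟨A, ⟨α⟩⟩ := h.dense (k := k) hs M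
    obtain ⟨B, ⟨β⟩⟩ := h.dense (k := k) hs N
    obtain ⟨j', hj'⟩ := F.map_surjective (α.hom ≫ j ≫ β.inv)
    obtain ⟨g', hg'⟩ := F.map_surjective (α.hom ≫ g)
    have hm : Mono (F.map j') := by rw [hj']; infer_instance
    -- Extend the linear form on `Hom(X, A)` that corresponds to `g'` along the injection `j'`.
    let J : (X ⟶ A) →ₗ[k] (X ⟶ B) := Linear.rightComp k X j'
    have hJ : LinearMap.ker J = ⊥ := LinearMap.ker_eq_bot'.2 fun x hx =>
      eq_zero_of_homFunctor_mono k j' x hx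
    obtain ⟨J', hJ'⟩ := J.exists_leftInverse_of_injective hJ
    let l : Module.Dual k (X ⟶ A) :=
      (Module.Dual.eval k (A ⟶ X⟦d⟧) g').comp (cyDuality hCY X A).toLinearMap
    obtain ⟨e, he⟩ := exists_cyDuality_eq hCY (l.comp J')
    have hje : j' ≫ e = g' := by
      rw [← sub_eq_zero]
      apply (Module.forall_dual_apply_eq_zero_iff k _).1
      intro f
      obtain ⟨x, rfl⟩ := (cyDuality hCY X A).surjective f
      have hx : J' (x ≫ j') = x := LinearMap.congr_fun hJ' x
      rw [map_sub, ← cyDuality_comp_right, he, sub_eq_zero, LinearMap.comp_apply, hx]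
      rfl
    refine ⟨β.inv ≫ F.map e, ?_⟩
    rw [← cancel_epi α.hom, ← hg', ← hje, Functor.map_comp, hj']
    simp

/-- `F T[1] = 0`, and `F T[j]` is injective for `2 ≤ j ≤ d`. -/
lemma injective (h : IsTiltingPair d T X) (hs : SubProjective (End X)ᵐᵒᵖ)
    (hCY : IsCalabiYau k C d) {A : C} (hA : shiftAdd T 1 d A) :
    Injective ((homFunctor k X).obj A) := by
  have := h.two_le
  refine hA _ (isAddClosed_injective.comap (homFunctor k X)) fun j h₁ h₂ => ?_
  rcases eq_or_lt_of_le h₁ with rfl | h₃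
  · refine (homFunctor_obj_isZero_iff.2 fun x => ?_).injective
    exact h.hom_zero (by lia) (by lia) ((h.add_iff X).1 (addClosure_self X))
      (shiftAdd_shift_self le_rfl le_rfl) x
  · exact addClosure_induction (isAddClosed_injective.comap (homFunctor k X))
      (h.injective_shift hs hCY) ((h.addClosure_shift_iff _).2 (shiftAdd_shift_self (by lia) h₂))

omit [IsIdempotentComplete C] [IsNoetherianRing (End X)ᵐᵒᵖ] in
/-- The functor `F` is faithful on morphisms to objects of `add X[d]`. -/
lemma eq_zero_of_tgt (h : IsTiltingPair d T X) (hCY : IsCalabiYau k C d) {A Z : C}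
    (hZ : shiftAdd T 2 d Z) (f : A ⟶ Z) (hf : (homFunctor k X).map f = 0) : f = 0 := by
  rw [homFunctor_map_eq_zero_iff] at hf
  rw [← h.addClosure_shift_iff] at hZ
  revert f
  refine addClosure_induction
    (Q := fun Z => ∀ f : A ⟶ Z, (∀ x : X ⟶ A, x ≫ f = 0) → f = 0) ?_ ?_ hZ
  · exact {
      of_isZero := fun _ h _ _ => h.eq_of_tgt _ _
      biprod := fun U V hU hV f hf => by
        ext
        · rw [zero_comp]; exact hU _ fun x => by rw [← Category.assoc, hf, zero_comp]
        · rw [zero_comp]; exact hV _ fun x => by rw [← Category.assoc, hf, zero_comp]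
      of_retract := fun U V r hV f hf => by
        rw [← Category.comp_id f, ← r.retract, ← Category.assoc,
          hV (f ≫ r.i) (fun x => by rw [← Category.assoc, hf, zero_comp]), zero_comp] }
  · exact fun f hf => eq_zero_of_forall_comp_eq_zero hCY f hf

omit [HasZeroObject C] [∀ n : ℤ, (shiftFunctor C n).Additive]
  [Pretriangulated C] [IsIdempotentComplete C] [IsNoetherianRing (End X)ᵐᵒᵖ] in
/-- The functor `F` maps left `add X[d]`-approximations to monomorphisms. -/
lemma mono_left_approx (hCY : IsCalabiYau k C d) {B Z : C} (q : B ⟶ Z)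
    (hq : ∀ x : B ⟶ X⟦d⟧, ∃ y : Z ⟶ X⟦d⟧, q ≫ y = x) : Mono ((homFunctor k X).map q) :=
  homFunctor_mono _ fun x hx => eq_zero_of_forall_comp_shift_eq_zero hCY x fun g => by
    obtain ⟨y, rfl⟩ := hq g
    rw [← Category.assoc, hx, zero_comp]

/-- If `F B` is injective, then some morphism from `B` to an object of `add X[d]` becomes an
isomorphism under `F`. -/
lemma exists_isIso_of_injective (h : IsTiltingPair d T X) (hs : SubProjective (End X)ᵐᵒᵖ)
    (hCY : IsCalabiYau k C d) (B : C) (hB : Injective ((homFunctor k X).obj B)) :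
    ∃ (Z : C) (j : B ⟶ Z), shiftAdd T 2 d Z ∧ IsIso ((homFunctor k X).map j) := by
  let F := homFunctor k X
  have hfull : F.Full := h.full (k := k) hs
  obtain ⟨Z, q, hZ, hq⟩ := exists_left_approx k (X⟦d⟧) B
  rw [h.addClosure_shift_iff] at hZ
  have hm : Mono (F.map q) := mono_left_approx hCY q hq
  let r : F.obj Z ⟶ F.obj B := Injective.factorThru (𝟙 _) (F.map q)
  have hr : F.map q ≫ r = 𝟙 _ := Injective.comp_factorThru _ _
  obtain ⟨e, he⟩ := F.map_surjective (r ≫ F.map q)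
  have hee : e ≫ e = e := by
    rw [← sub_eq_zero]
    apply h.eq_zero_of_tgt hCY hZ
    change F.map _ = 0
    rw [Functor.map_sub, Functor.map_comp, he, Category.assoc, reassoc_of% hr, sub_self]
  obtain ⟨Y, i, p, hip, hpi⟩ := IsIdempotentComplete.idempotents_split Z e hee
  refine ⟨Y, q ≫ p, (isAddClosed_shiftAdd T _ _).of_retract _ _ ⟨i, p, hip⟩ hZ,
    ⟨F.map i ≫ r, ?_, ?_⟩⟩
  · change F.map (q ≫ p) ≫ F.map i ≫ r = _
    rw [← Functor.map_comp_assoc, Category.assoc, hpi, Functor.map_comp, he, Category.assoc,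
      Category.assoc, hr, Category.comp_id, hr]
  · change (F.map i ≫ r) ≫ F.map (q ≫ p) = _
    rw [Functor.map_comp, Category.assoc, ← reassoc_of% he, ← Functor.map_comp,
      ← Functor.map_comp, ← hpi]
    simp [hip, F]

/-- The objects whose image under `F` is injective belong to `add (T[1] ⊞ X[d])`. -/
lemma shiftAdd_of_injective (h : IsTiltingPair d T X) (hs : SubProjective (End X)ᵐᵒᵖ)
    (hCY : IsCalabiYau k C d) (B : C) (hB : Injective ((homFunctor k X).obj B)) :
    shiftAdd T 1 d B := by
  have := h.two_le
  obtain ⟨Z, j, hZ, hj⟩ := h.exists_isIso_of_injective hs hCY B hB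
  obtain ⟨W, w, u, hT⟩ := distinguished_cocone_triangle j
  have hjX : ∀ {Y : C}, shiftAdd T (2 - d) 0 Y → ∀ f : Y ⟶ B, f ≫ j = 0 → f = 0 :=
    fun hY f hf => by
      apply eq_zero_of_addClosure (k := k) ((h.add_iff _).2 hY)
      rw [← cancel_mono ((homFunctor k X).map j), ← Functor.map_comp, hf, Functor.map_zero,
        zero_comp]
  have hjX' : ∀ {Y : C}, shiftAdd T (2 - d) 0 Y → ∀ f : Y ⟶ Z, ∃ g : Y ⟶ B, g ≫ j = f :=
    fun hY => addClosure_induction (isAddClosed_surjective_comp j)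
      (exists_lift_of_homFunctor_epi k j) ((h.add_iff _).2 hY)
  -- There are no nonzero morphisms from `X[1]` to the cone `W`, hence `W` belongs to `add T[2]`.
  have hW : shiftAdd T 2 2 W := by
    refine h.shiftAdd_of_hom_zero 1 fun i h₁ h₂ y => ?_
    have hyu : y ≫ u = 0 := by
      refine injective_comp_shift j 1 (-1) (by lia) (hjX ?_) _ (by
        rw [Category.assoc, dist_comp₃₁ hT, comp_zero])
      exact shiftAdd_shift (a := 3 - d) (b := 1) (-1) (by lia) (by lia)
        (shiftAdd_shift_self (by lia) h₂)
    obtain ⟨g, rfl⟩ := dist_lift₃ hT y hyu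
    rcases eq_or_lt_of_le h₂ with rfl | h₃
    · rw [h.hom_zero (by lia) (by lia) (shiftAdd_shift_self le_rfl le_rfl) hZ g, zero_comp]
    · obtain ⟨f, rfl⟩ := hjX' (shiftAdd_shift_self (by lia) (by lia)) g
      rw [Category.assoc, dist_comp₁₂ hT, comp_zero]
  -- The triangle splits, and `B` is the direct sum of `W[-1]` and `Z`.
  have hw : w = 0 := by
    refine h.eq_zero_of_tgt hCY (shiftAdd_mono le_rfl h.two_le hW) w ?_
    rw [← cancel_epi ((homFunctor k X).map j), ← Functor.map_comp, dist_comp₁₂ hT,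
      Functor.map_zero, comp_zero]
  obtain ⟨e, -, -⟩ := exists_iso_binaryBiproduct_of_distTriang _ (inv_rot_of_distTriang _ hT)
    ((congrArg (· ≫ _) hw).trans zero_comp)
  have hadd := isAddClosed_shiftAdd T 1 d
  exact hadd.of_retract _ _ (Retract.ofIso e) (hadd.biprod _ _
    (shiftAdd_shift (-1) (by lia) (by lia) (shiftAdd_mono le_rfl h.two_le hW) |>
      shiftAdd_mono (a := 1) (b := d - 1) le_rfl (by lia))
    (shiftAdd_mono (by lia) le_rfl hZ))

/-- Morphisms killed by `F` factor through `add (T[1] ⊞ X[d])`. In the triangle `L ⟶ B ⟶ Z` of a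
left `add X[d]`-approximation of `B`, the module `F L` is a quotient of the injective module
`F Z[-1]`. -/
lemma factorsThru_injective_of_map_eq_zero (h : IsTiltingPair d T X)
    (hs : SubProjective (End X)ᵐᵒᵖ) (hCY : IsCalabiYau k C d) {A B : C} (f : A ⟶ B)
    (hf : (homFunctor k X).map f = 0) : FactorsThru (shiftAdd T 1 d) f := by
  obtain ⟨Z, q, hZ, hq⟩ := exists_left_approx k (X⟦d⟧) B
  rw [h.addClosure_shift_iff] at hZ
  have hm := mono_left_approx hCY q hq
  obtain ⟨L, l, δ, hT⟩ := distinguished_cocone_triangle₁ q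
  obtain ⟨ε, q', hT'⟩ : ∃ ε q', Triangle.mk (C := C) ε l q' ∈ distTriang C :=
    ⟨_, _, inv_rot_of_distTriang _ hT⟩
  have hinj : Injective ((homFunctor k X).obj (Z⟦(-1 : ℤ)⟧)) := h.injective hs hCY
    (shiftAdd_mono (a := 1) (b := d - 1) le_rfl (by lia)
      (shiftAdd_shift (-1) (by lia) (by lia) hZ))
  have hepi : Epi ((homFunctor k X).map (show Z⟦(-1 : ℤ)⟧ ⟶ L from ε)) :=
    homFunctor_epi _ fun x => by
      refine dist_lift₂ hT' x (eq_zero_of_homFunctor_mono k q _ ?_)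
      rw [Category.assoc, dist_comp₁₂ hT, comp_zero]
  have hL : Injective ((homFunctor k X).obj L) :=
    injective_of_epi hs ((homFunctor k X).map (show Z⟦(-1 : ℤ)⟧ ⟶ L from ε))
  obtain ⟨g, hg⟩ := dist_lift₂ hT f (h.eq_zero_of_tgt hCY hZ _ (by
    rw [Functor.map_comp, hf, zero_comp]))
  exact ⟨L, h.shiftAdd_of_injective hs hCY L hL, g, l, hg⟩

end IsTiltingPair

end Duality

/-! ### Projective resolutions of the modules `F A` -/

section Resolutions

open Pretriangulated

variable {k : Type v} [Field k] {C : Type u} [Category.{v} C] [Preadditive C] [Linear k C]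
  [HomFinite k C] [HasZeroObject C] [HasShift C ℤ] [∀ n : ℤ, (shiftFunctor C n).Additive]
  [Pretriangulated C] [IsIdempotentComplete C]
  {d : ℤ} {T X : C} [IsNoetherianRing (End X)ᵐᵒᵖ]

namespace IsTiltingPair

/-- Let `S` be a class of objects through which all morphisms killed by `F` factor. If `S`
contains the objects whose image lies in `Q`, then `F` reflects factorizations through `Q`. -/
lemma factorsThru_of_map (h : IsTiltingPair d T X) (hs : SubProjective (End X)ᵐᵒᵖ)
    {S : ObjectProperty C} (hS : IsAddClosed S) {Q : ObjectProperty (FGModuleCat.{v} (End X)ᵐᵒᵖ)}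
    (hQ : IsAddClosed Q) (hSQ : ∀ A : C, Q ((homFunctor k X).obj A) → S A)
    (hg : ∀ {A B : C} (f : A ⟶ B), (homFunctor k X).map f = 0 → FactorsThru S f)
    {A B : C} (f : A ⟶ B) (hf : FactorsThru Q ((homFunctor k X).map f)) : FactorsThru S f := by
  have hfull := h.full (k := k) hs
  obtain ⟨M, hM, a, b, hab⟩ := hf
  obtain ⟨Z, ⟨e⟩⟩ := h.dense (k := k) hs M
  obtain ⟨a', ha'⟩ := (homFunctor k X).map_surjective (a ≫ e.inv)
  obtain ⟨b', hb'⟩ := (homFunctor k X).map_surjective (e.hom ≫ b)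
  have hZ : S Z := hSQ Z (hQ.of_retract _ _ (Retract.ofIso e) hM)
  have h0 := hg (f - a' ≫ b') (by
    rw [Functor.map_sub, Functor.map_comp, ha', hb', Category.assoc, e.inv_hom_id_assoc, hab,
      sub_self])
  have := h0.add hS ⟨Z, hZ, a', b', rfl⟩
  rwa [sub_add_cancel] at this

/-- If `A` has no nonzero summand in `add (X ⊞ T[1])`, then there are no nonzero morphisms from
`F A` to projective modules: the image of such a morphism is projective, and is therefore the image
under `F` of a summand of `A` in `add X`. -/
lemma eq_zero_of_projective (h : IsTiltingPair d T X) (hs : SubProjective (End X)ᵐᵒᵖ) {A : C}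
    (hA : noSummandIn (shiftAdd T (2 - d) 1) A) {P : FGModuleCat.{v} (End X)ᵐᵒᵖ}
    (hP : Projective P) (f : (homFunctor k X).obj A ⟶ P) : f = 0 := by
  have hI : Projective (image f) := hs _ _ (image.ι f) hP
  obtain ⟨Y, β, ρ, σ, hY, hσρ, hρ⟩ := h.exists_split_of_epi hs (factorThruImage f)
  have hY0 := hA Y (shiftAdd_mono le_rfl (by lia) ((h.add_iff _).1 hY)) ⟨⟨σ, ρ, hσρ⟩⟩
  rw [← image.fac f, ← hρ, hY0.eq_of_tgt ρ 0, Functor.map_zero, zero_comp, zero_comp]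

/-- An object `A` without nonzero summands in `add (X ⊞ T[1])` is the cone of a morphism
`u : X₁ ⟶ X₀` of `add X` that `F` maps to a projective resolution of `F A`. -/
lemma exists_resolution (h : IsTiltingPair d T X) (hs : SubProjective (End X)ᵐᵒᵖ) {A : C}
    (hA : noSummandIn (shiftAdd T (2 - d) 1) A) :
    ∃ (X₁ X₀ : C) (u : X₁ ⟶ X₀) (c : X₀ ⟶ A) (δ : A ⟶ X₁⟦(1 : ℤ)⟧),
      Triangle.mk u c δ ∈ distTriang C ∧ shiftAdd T (2 - d) 0 X₁ ∧ shiftAdd T (2 - d) 0 X₀ ∧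
      Mono ((homFunctor k X).map u) ∧ ∀ x : X ⟶ A, ∃ y : X ⟶ X₀, y ≫ c = x := by
  let F := homFunctor k X
  obtain ⟨K, Z, κ, p, δ, hT, hZ, hp⟩ := h.exists_approx_triangle k A
  have hI : Projective (image (F.map κ)) :=
    hs _ _ (image.ι (F.map κ)) (projective_of_addClosure ((h.add_iff _).2 hZ))
  obtain ⟨Y, β, ρ, σ, hY, hσρ, hρ⟩ := h.exists_split_of_epi hs (factorThruImage (F.map κ))
  have hκ : F.map κ = F.map ρ ≫ β.hom ≫ image.ι (F.map κ) := by
    rw [reassoc_of% hρ, image.fac]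
  -- The complement of `Y` in `K` maps to zero in `Z`, so its shift is a summand of `A`.
  let e : K ⟶ K := 𝟙 K - ρ ≫ σ
  have hee : e ≫ e = e := by simp [e, Preadditive.comp_sub, Preadditive.sub_comp, reassoc_of% hσρ]
  have heκ : e ≫ κ = 0 := by
    have := h.comp_eq_zero_of_map_eq_zero (k := k) (h.fibre_approx (k := k) hs hT hZ hp) hZ
      (e ≫ κ) (𝟙 Z) (by
        have : e ≫ ρ = 0 := by simp [e, Preadditive.sub_comp, hσρ]
        change F.map _ = 0
        rw [Category.comp_id, Functor.map_comp, hκ, ← Category.assoc, ← Functor.map_comp, this,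
          Functor.map_zero, zero_comp])
    rwa [Category.comp_id] at this
  obtain ⟨y, hy⟩ := dist_lift₁ hT (e⟦(1 : ℤ)⟧') (by
    rw [← Functor.map_comp, heκ, Functor.map_zero])
  have he1 : e⟦(1 : ℤ)⟧' = 0 := idempotent_eq_zero (isAddClosed_shiftAdd T _ _)
    (by rw [← Functor.map_comp, hee]) hy hA (Category.id_comp _)
    (h.cone_approx (k := k) hs hT hZ hp)
  have he0 : e = 0 := (shiftFunctor C (1 : ℤ)).map_injective (by rw [he1, Functor.map_zero])
  let i : K ≅ Y := ⟨ρ, σ, (sub_eq_zero.1 he0).symm, hσρ⟩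
  refine ⟨K, Z, κ, p, δ, hT, (isAddClosed_shiftAdd T _ _).of_retract _ _ (Retract.ofIso i)
    ((h.add_iff _).1 hY), hZ, ?_, hp⟩
  have : IsIso (F.map ρ) := (F.mapIso i).isIso_hom
  change Mono (F.map κ)
  rw [hκ]
  infer_instance

/-- Every morphism from an object `A` without nonzero summands in `add (X ⊞ T[1])` to `Y[1]`,
`Y` in `add X`, factors through the connecting morphism of the resolution of `A`. -/
lemma exists_eq_comp_shift (h : IsTiltingPair d T X) (hs : SubProjective (End X)ᵐᵒᵖ)
    {A X₁ X₀ Y : C} (hA : noSummandIn (shiftAdd T (2 - d) 1) A)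
    {u : X₁ ⟶ X₀} {c : X₀ ⟶ A} {δ : A ⟶ X₁⟦(1 : ℤ)⟧} (hT : Triangle.mk u c δ ∈ distTriang C)
    (hX₀ : shiftAdd T (2 - d) 0 X₀) (hY : shiftAdd T (2 - d) 0 Y) (g : A ⟶ Y⟦(1 : ℤ)⟧) :
    (homFunctor k X).map g = 0 ∧ ∃ y : X₁ ⟶ Y, δ ≫ y⟦(1 : ℤ)⟧' = g := by
  have hg := h.eq_zero_of_projective hs hA (h.projective (k := k)
    (shiftAdd_mono (a := 3 - d) (b := 1) (by lia) (by lia)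
      (shiftAdd_shift 1 (by lia) (by lia) hY))) ((homFunctor k X).map g)
  refine ⟨hg, ?_⟩
  obtain ⟨z, hz⟩ := dist_desc₃ hT g (h.comp_eq_zero hX₀ g hg c)
  obtain ⟨y, rfl⟩ := (shiftFunctor C (1 : ℤ)).map_surjective z
  exact ⟨y, hz⟩

include k in
/-- If `A` has no nonzero summands in `add (X ⊞ T[1])` and `Y` belongs to `add X`, then `F` maps
each triangle `Y ⟶ E ⟶ A ⟶ Y[1]` to a short exact sequence. -/
lemma mono_and_lift_of_dist (h : IsTiltingPair d T X) (hs : SubProjective (End X)ᵐᵒᵖ) {A Y E : C}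
    (hA : noSummandIn (shiftAdd T (2 - d) 1) A) (hY : shiftAdd T (2 - d) 0 Y)
    {f : Y ⟶ E} {p : E ⟶ A} {g : A ⟶ Y⟦(1 : ℤ)⟧} (hT : Triangle.mk f p g ∈ distTriang C) :
    (∀ x : X ⟶ Y, x ≫ f = 0 → x = 0) ∧ ∀ x : X ⟶ A, ∃ y : X ⟶ E, y ≫ p = x := by
  obtain ⟨X₁, X₀, u, c, δ, hT', hX₁, hX₀, hu, hc⟩ := h.exists_resolution (k := k) hs hA
  obtain ⟨hg, y, rfl⟩ := h.exists_eq_comp_shift (k := k) hs hA hT' hX₀ hY g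
  refine ⟨fun x hx => ?_, fun x => dist_lift₃ hT x ((homFunctor_map_eq_zero_iff _).1 hg x)⟩
  obtain ⟨z, hz⟩ := dist_lift₁ hT (x⟦(1 : ℤ)⟧') (by
    rw [← Functor.map_comp, hx, Functor.map_zero])
  obtain ⟨w, hw⟩ := (shiftFunctor C (1 : ℤ)).map_surjective (z ≫ δ)
  have hw0 : w = 0 := eq_zero_of_homFunctor_mono k u w
    ((shiftFunctor C (1 : ℤ)).map_injective (by
      rw [Functor.map_comp, hw, Category.assoc, dist_comp₃₁ hT', comp_zero, Functor.map_zero]))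
  apply (shiftFunctor C (1 : ℤ)).map_injective
  rw [← hz, ← Category.assoc, ← hw, hw0, Functor.map_zero, zero_comp, Functor.map_zero]

end IsTiltingPair

end Resolutions

/-! ### Indecomposable objects -/

section Indecomposables

variable {k : Type v} [Field k] {C : Type u} [Category.{v} C] [Preadditive C] [Linear k C]
  [HomFinite k C] [HasZeroObject C] [HasFiniteBiproducts C] [HasBinaryBiproducts C]
  [IsIdempotentComplete C]
  {D : Type*} [Category D] [Preadditive D]

include k in
variable (k) in
omit [HasZeroObject C] [HasFiniteBiproducts C] [HasBinaryBiproducts C] in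
/-- If `F` does not kill the indecomposable object `A`, then an endomorphism of `A` that `F` maps to
an isomorphism is not nilpotent, hence an isomorphism. -/
lemma IsIndecomposable.isIso_of_map_isIso (F : C ⥤ D) [F.Additive] {A : C}
    (hA : IsIndecomposable A) (hFA : ¬ IsZero (F.obj A)) (f : A ⟶ A) [IsIso (F.map f)] :
    IsIso f := by
  have : Module.Finite k (A ⟶ A) := HomFinite.finite_hom A A
  rcases hA.isNilpotent_or_isUnit k (show End A from f) with ⟨n, hn⟩ | hf
  · exfalso
    have hpow : ∀ m : ℕ, IsIso (F.map ((show End A from f) ^ m : End A)) := fun m => by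
      induction m with
      | zero => exact inferInstanceAs (IsIso (F.map (𝟙 A)))
      | succ m ih =>
        have e : F.map ((show End A from f) ^ (m + 1) : End A) =
          F.map f ≫ F.map ((show End A from f) ^ m : End A) := by
          rw [pow_succ, End.mul_def, Functor.map_comp]
        rw [e]; infer_instance
    have := hpow n
    rw [hn] at this
    apply hFA
    rw [IsZero.iff_id_eq_zero, ← IsIso.hom_inv_id (F.map (0 : End A))]
    have e0 : F.map (0 : End A) = 0 := F.map_zero A A
    exact (congrArg (· ≫ _) e0).trans zero_comp
  · obtain ⟨g, h₁, h₂⟩ := isUnit_iff_exists.1 hf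
    exact ⟨g, h₂, h₁⟩

include k in
variable (k) in
omit [HasZeroObject C] in
/-- A full and dense functor `F` induces a bijection from the isomorphism classes of
indecomposable objects that are not killed by `F` to those of indecomposable objects of the
target. -/
lemma bijOn_mapIsoClasses (F : C ⥤ D) [F.Additive] [F.Full]
    (hdense : ∀ M : D, ∃ A : C, Nonempty (F.obj A ≅ M)) {P : ObjectProperty C}
    (hP : IsAddClosed P) (hPF : ∀ A, P A ↔ IsZero (F.obj A)) :
    Set.BijOn (mapIsoClasses F) (ind C \ indIn P) (ind D) := by
  have hP' : ∀ {A : C}, IsIndecomposable A →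
      (_root_.Quotient.mk _ A : IsoClasses C) ∉ indIn P → ¬ IsZero (F.obj A) :=
    fun hA hn h0 => hn ⟨_, hA, (hPF _).2 h0, rfl⟩
  refine ⟨?_, ?_, ?_⟩
  · rintro _ ⟨⟨A, hA, -, rfl⟩, hn⟩
    have hFA := hP' hA hn
    refine ⟨F.obj A, ⟨hFA, fun Y Z b hb ⟨e⟩ => ?_⟩, trivial, rfl⟩
    -- Lift the projection of `F A` onto the summand `Y` to an endomorphism of `A`.
    obtain ⟨f, hf⟩ := F.map_surjective (e.hom ≫ b.fst ≫ b.inl ≫ e.inv)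
    have hff : F.map f ≫ F.map f = F.map f := by rw [hf]; simp
    have hf' : e.inv ≫ F.map f ≫ e.hom = b.fst ≫ b.inl := by rw [hf]; simp
    have : Module.Finite k (A ⟶ A) := HomFinite.finite_hom A A
    rcases hA.isNilpotent_or_isUnit k (show End A from f) with ⟨n, hn⟩ | hu
    · left
      have hpow : ∀ m : ℕ, F.map ((show End A from f) ^ (m + 1) : End A) = F.map f := fun m => by
        induction m with
        | zero => rw [pow_one]
        | succ m ih => rw [pow_succ, End.mul_def, Functor.map_comp, ih, hff]
      have h0 : F.map f = 0 := by
        rw [← hpow n, pow_succ, hn, zero_mul]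
        exact F.map_zero A A
      rw [h0, zero_comp, comp_zero] at hf'
      rw [IsZero.iff_id_eq_zero, ← b.inl_fst, ← Category.comp_id (b.inl ≫ b.fst), ← b.inl_fst,
        Category.assoc, ← Category.assoc b.fst, ← hf', zero_comp, comp_zero]
    · right
      obtain ⟨g, h₁, h₂⟩ := isUnit_iff_exists.1 hu
      have hgf : g ≫ f = 𝟙 A := h₁
      have h1 : F.map f = 𝟙 _ := by
        have := F.map g ≫= hff
        rwa [← Category.assoc, ← F.map_comp, hgf, F.map_id, Category.id_comp] at this
      rw [h1, Category.id_comp, e.inv_hom_id] at hf'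
      rw [IsZero.iff_id_eq_zero, ← b.inr_snd, ← Category.id_comp b.snd, hf', Category.assoc,
        ← Category.assoc b.inr, b.inr_fst, zero_comp]
  · rintro _ ⟨⟨A, hA, -, rfl⟩, hn⟩ _ ⟨⟨B, hB, -, rfl⟩, hn'⟩ hAB
    obtain ⟨e⟩ : Nonempty (F.obj A ≅ F.obj B) := Quotient.exact hAB
    obtain ⟨a, ha⟩ := F.map_surjective e.hom
    obtain ⟨b, hb⟩ := F.map_surjective e.inv
    have h₁ : IsIso (F.map (a ≫ b)) := by
      rw [Functor.map_comp, ha, hb, e.hom_inv_id]; infer_instance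
    have h₂ : IsIso (F.map (b ≫ a)) := by
      rw [Functor.map_comp, ha, hb, e.inv_hom_id]; infer_instance
    have h₃ := hA.isIso_of_map_isIso k F (hP' hA hn) (a ≫ b)
    have h₄ := hB.isIso_of_map_isIso k F (hP' hB hn') (b ≫ a)
    have h₅ : IsIso a := by
      have : IsSplitMono a := ⟨⟨⟨b ≫ inv (a ≫ b), by
        rw [← Category.assoc, IsIso.hom_inv_id]⟩⟩⟩
      have : Epi a := epi_of_epi b a
      exact isIso_of_epi_of_isSplitMono a
    exact _root_.Quotient.sound ⟨asIso a⟩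
  · rintro _ ⟨M, hM, -, rfl⟩
    obtain ⟨A, ⟨e⟩⟩ := hdense M
    obtain ⟨A', i, p, hip, hpi, hA'⟩ := exists_noSummandIn
      (fun A B => HomFinite.finite_hom (k := k) A B) hP A
    have hFpi : F.map p ≫ F.map i = 𝟙 _ := by
      obtain ⟨Z, hZ, a, b, hab⟩ := hpi
      rw [← F.map_comp, eq_comm, ← sub_eq_zero, ← F.map_id, ← F.map_sub, ← hab, F.map_comp,
        ((hPF Z).1 hZ).eq_of_tgt (F.map a) 0, zero_comp]
    let e' : F.obj A' ≅ M :=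
      ⟨F.map i, F.map p, by rw [← F.map_comp, hip, F.map_id], hFpi⟩ ≪≫ e
    have hz : ∀ {Y : C}, P Y → Nonempty (Retract Y A') → IsZero Y := fun hY hr => hA' _ hY hr
    have hA0 : ¬ IsZero (F.obj A') := fun h => hM.1 (h.of_iso e'.symm)
    refine ⟨_root_.Quotient.mk _ A', ⟨⟨A', ⟨fun h => hA0 (F.map_isZero h),
      fun Y Z b hb ⟨ε⟩ => ?_⟩, trivial, rfl⟩, ?_⟩, _root_.Quotient.sound ⟨e'⟩⟩
    · let Fb : BinaryBicone (F.obj Y) (F.obj Z) := F.mapBinaryBicone b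
      have hFb : Fb.IsBilimit := isBinaryBilimitOfTotal _ (by
        have := F.congr_map (IsBilimit.binary_total hb)
        rwa [F.map_add, F.map_comp, F.map_comp, F.map_id] at this)
      rcases hM.2 _ _ Fb hFb ⟨e'.symm ≪≫ F.mapIso ε⟩ with h | h
      · exact Or.inl (hz ((hPF _).2 h) ⟨⟨b.inl ≫ ε.inv, ε.hom ≫ b.fst, by simp⟩⟩)
      · exact Or.inr (hz ((hPF _).2 h) ⟨⟨b.inr ≫ ε.inv, ε.hom ≫ b.snd, by simp⟩⟩)
    · rintro ⟨B, -, hB, hAB⟩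
      obtain ⟨ε⟩ : Nonempty (A' ≅ B) := Quotient.exact hAB
      exact hA0 (((hPF _).1 hB).of_iso (F.mapIso ε))

end Indecomposables

/-! ### Extensions of modules defined by triangles -/

section Extensions

open Pretriangulated Abelian

variable {k : Type v} [Field k] {C : Type u} [Category.{v} C] [Preadditive C] [Linear k C]
  [HomFinite k C] [HasZeroObject C] [HasShift C ℤ] [∀ n : ℤ, (shiftFunctor C n).Additive]
  [Pretriangulated C]

/-- The image of a triangle under `Hom(X, -)`. -/
abbrev coyonedaComplex (X : C) {Y E A : C} {f : Y ⟶ E} {p : E ⟶ A} {g : A ⟶ Y⟦(1 : ℤ)⟧}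
    (hT : Triangle.mk f p g ∈ distTriang C) : ShortComplex (ModuleCat.{v} (End X)ᵐᵒᵖ) :=
  ShortComplex.mk ((preadditiveCoyonedaObj X).map f) ((preadditiveCoyonedaObj X).map p)
    (by rw [← Functor.map_comp, dist_comp₁₂ hT, Functor.map_zero])

omit [Linear k C] [HomFinite k C] in
lemma coyonedaComplex_shortExact {X Y E A : C} {f : Y ⟶ E} {p : E ⟶ A} {g : A ⟶ Y⟦(1 : ℤ)⟧}
    (hT : Triangle.mk f p g ∈ distTriang C) (hf : ∀ x : X ⟶ Y, x ≫ f = 0 → x = 0)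
    (hp : ∀ x : X ⟶ A, ∃ y : X ⟶ E, y ≫ p = x) : (coyonedaComplex X hT).ShortExact where
  exact := (ShortComplex.moduleCat_exact_iff _).2 fun x hx => dist_lift₂ hT x hx
  mono_f := (ModuleCat.mono_iff_injective _).2 ((injective_iff_map_eq_zero _).2 hf)
  epi_g := (ModuleCat.epi_iff_surjective _).2 hp

/-- The class of the short exact sequence of modules that arises from a triangle. -/
def triangleClass {X Y E A : C} {f : Y ⟶ E} {p : E ⟶ A} {g : A ⟶ Y⟦(1 : ℤ)⟧}
    {hT : Triangle.mk f p g ∈ distTriang C} (h : (coyonedaComplex X hT).ShortExact) :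
    Ext ((preadditiveCoyonedaObj X).obj A) ((preadditiveCoyonedaObj X).obj Y) 1 :=
  h.extClass

omit [Linear k C] [HomFinite k C] in
/-- Morphisms of triangles are compatible with the extensions of modules. -/
lemma triangleClass_naturality {X Y E A Y' E' A' : C} {f : Y ⟶ E} {p : E ⟶ A}
    {g : A ⟶ Y⟦(1 : ℤ)⟧} {hT : Triangle.mk f p g ∈ distTriang C}
    (h : (coyonedaComplex X hT).ShortExact) {f' : Y' ⟶ E'} {p' : E' ⟶ A'}
    {g' : A' ⟶ Y'⟦(1 : ℤ)⟧} {hT' : Triangle.mk f' p' g' ∈ distTriang C}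
    (h' : (coyonedaComplex X hT').ShortExact) (y : Y ⟶ Y') (a : A ⟶ A')
    (hya : g ≫ y⟦(1 : ℤ)⟧' = a ≫ g') :
    (triangleClass h).comp (Ext.mk₀ ((preadditiveCoyonedaObj X).map y)) (add_zero 1) =
      (Ext.mk₀ ((preadditiveCoyonedaObj X).map a)).comp (triangleClass h') (zero_add 1) := by
  obtain ⟨e, he₁, he₂⟩ : ∃ e : E ⟶ E', f ≫ e = y ≫ f' ∧ p ≫ a = e ≫ p' :=
    complete_distinguished_triangle_morphism₂ _ _ hT hT' y a hya
  let φ : coyonedaComplex X hT ⟶ coyonedaComplex X hT' :=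
    { τ₁ := (preadditiveCoyonedaObj X).map y
      τ₂ := (preadditiveCoyonedaObj X).map e
      τ₃ := (preadditiveCoyonedaObj X).map a
      comm₁₂ := by
        change (preadditiveCoyonedaObj X).map _ ≫ (preadditiveCoyonedaObj X).map _ =
          (preadditiveCoyonedaObj X).map _ ≫ (preadditiveCoyonedaObj X).map _
        rw [← Functor.map_comp, ← Functor.map_comp, he₁]
      comm₂₃ := by
        change (preadditiveCoyonedaObj X).map _ ≫ (preadditiveCoyonedaObj X).map _ =
          (preadditiveCoyonedaObj X).map _ ≫ (preadditiveCoyonedaObj X).map _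
        rw [← Functor.map_comp, ← Functor.map_comp, he₂] }
  exact ShortComplex.ShortExact.extClass_naturality h h' φ

omit [Linear k C] [HomFinite k C] in
lemma exists_of_triangleClass_comp_eq_zero {X Y E A : C} {f : Y ⟶ E} {p : E ⟶ A}
    {g : A ⟶ Y⟦(1 : ℤ)⟧} {hT : Triangle.mk f p g ∈ distTriang C}
    (h : (coyonedaComplex X hT).ShortExact) {M : ModuleCat.{v} (End X)ᵐᵒᵖ}
    (φ : (preadditiveCoyonedaObj X).obj Y ⟶ M)
    (hφ : (triangleClass h).comp (Ext.mk₀ φ) (add_zero 1) = 0) :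
    ∃ ψ : (preadditiveCoyonedaObj X).obj E ⟶ M, (preadditiveCoyonedaObj X).map f ≫ ψ = φ := by
  obtain ⟨z, hz⟩ := Ext.contravariant_sequence_exact₁ h _ _ _ hφ
  obtain ⟨ψ, rfl⟩ := (Ext.mk₀_bijective _ _).2 z
  exact ⟨ψ, (Ext.mk₀_bijective _ _).1 ((Ext.mk₀_comp_mk₀ _ _).symm.trans hz)⟩

omit [Linear k C] [HomFinite k C] in
lemma exists_triangleClass_comp_eq {X Y E A : C} {f : Y ⟶ E} {p : E ⟶ A}
    {g : A ⟶ Y⟦(1 : ℤ)⟧} {hT : Triangle.mk f p g ∈ distTriang C}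
    (h : (coyonedaComplex X hT).ShortExact) (hE : Module.Projective (End X)ᵐᵒᵖ (X ⟶ E))
    {M : ModuleCat.{v} (End X)ᵐᵒᵖ} (ξ : Ext ((preadditiveCoyonedaObj X).obj A) M 1) :
    ∃ φ : (preadditiveCoyonedaObj X).obj Y ⟶ M,
      (triangleClass h).comp (Ext.mk₀ φ) (add_zero 1) = ξ := by
  have := (IsProjective.iff_projective (R := (End X)ᵐᵒᵖ) (X ⟶ E)).1 hE
  obtain ⟨z, hz⟩ := Ext.contravariant_sequence_exact₃ h _ ξ
    (Ext.eq_zero_of_projective (P := ModuleCat.of (End X)ᵐᵒᵖ (X ⟶ E)) _) (add_zero 1)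
  obtain ⟨φ, rfl⟩ := (Ext.mk₀_bijective _ _).2 z
  exact ⟨φ, hz⟩

variable [IsIdempotentComplete C] {d : ℤ} {T X : C} [IsNoetherianRing (End X)ᵐᵒᵖ]

variable (d T) in
/-- The objects without nonzero direct summands in `add (X ⊞ T[1])`. -/
abbrev reduced : ObjectProperty C := noSummandIn (shiftAdd T (2 - d) 1)

namespace IsTiltingPair

variable (h : IsTiltingPair d T X) (hs : SubProjective (End X)ᵐᵒᵖ)

include k h hs in
lemma shortExact {Y E A : C} (hA : reduced d T A) (hY : shiftAdd T (2 - d) 0 Y)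
    {f : Y ⟶ E} {p : E ⟶ A} {g : A ⟶ Y⟦(1 : ℤ)⟧} (hT : Triangle.mk f p g ∈ distTriang C) :
    (coyonedaComplex X hT).ShortExact :=
  have := h.mono_and_lift_of_dist (k := k) hs hA hY hT
  coyonedaComplex_shortExact hT this.1 this.2

omit [IsIdempotentComplete C] [IsNoetherianRing (End X)ᵐᵒᵖ] in
include h in
lemma mem_self : shiftAdd T (2 - d) 0 X := (h.add_iff X).1 (addClosure_self X)

omit [IsIdempotentComplete C] [IsNoetherianRing (End X)ᵐᵒᵖ] [Linear k C] [HomFinite k C] in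
variable (X) in
lemma exists_triangle {A : C} (g : A ⟶ X⟦(1 : ℤ)⟧) :
    ∃ (E : C) (f : X ⟶ E) (p : E ⟶ A), Triangle.mk f p g ∈ distTriang C :=
  distinguished_cocone_triangle₂ g

/-- The extension of `F A` by `F X` that belongs to a morphism `g : A ⟶ X[1]`, namely the image
under `F` of a triangle `X ⟶ E ⟶ A ⟶ X[1]`. -/
def extOf (k : Type v) [Field k] [Linear k C] [HomFinite k C] (h : IsTiltingPair d T X)
    (hs : SubProjective (End X)ᵐᵒᵖ) {A : C} (hA : reduced d T A) (g : A ⟶ X⟦(1 : ℤ)⟧) :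
    Ext ((preadditiveCoyonedaObj X).obj A) ((preadditiveCoyonedaObj X).obj X) 1 :=
  triangleClass (h.shortExact (k := k) hs hA h.mem_self
    (exists_triangle X g).choose_spec.choose_spec.choose_spec)

/-- The class of `g'` is compatible with morphisms to its triangle from other triangles. -/
lemma comp_extOf {A : C} (hA : reduced d T A) {Y E B : C} {f : Y ⟶ E} {p : E ⟶ B}
    {g : B ⟶ Y⟦(1 : ℤ)⟧} {hT : Triangle.mk f p g ∈ distTriang C}
    (hE : (coyonedaComplex X hT).ShortExact) (y : Y ⟶ X) (a : B ⟶ A) (g' : A ⟶ X⟦(1 : ℤ)⟧)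
    (hya : g ≫ y⟦(1 : ℤ)⟧' = a ≫ g') :
    (triangleClass hE).comp (Ext.mk₀ ((preadditiveCoyonedaObj X).map y)) (add_zero 1) =
      (Ext.mk₀ ((preadditiveCoyonedaObj X).map a)).comp (h.extOf k hs hA g') (zero_add 1) :=
  triangleClass_naturality hE _ y a hya

lemma extOf_precomp {A A' : C} (hA : reduced d T A) (hA' : reduced d T A') (a : A ⟶ A')
    (g : A' ⟶ X⟦(1 : ℤ)⟧) : h.extOf k hs hA (a ≫ g) =
      (Ext.mk₀ ((preadditiveCoyonedaObj X).map a)).comp (h.extOf k hs hA' g) (zero_add 1) := by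
  rw [← h.comp_extOf hs hA' (h.shortExact (k := k) hs hA h.mem_self
    (exists_triangle X (a ≫ g)).choose_spec.choose_spec.choose_spec) (𝟙 X) a g (by simp)]
  rw [CategoryTheory.Functor.map_id, Ext.comp_mk₀_id]
  rfl

lemma extOf_postcomp {A : C} (hA : reduced d T A) (g : A ⟶ X⟦(1 : ℤ)⟧) (e : X ⟶ X) :
    h.extOf k hs hA (g ≫ e⟦(1 : ℤ)⟧') = (h.extOf k hs hA g).comp
      (Ext.mk₀ ((preadditiveCoyonedaObj X).map e)) (add_zero 1) := by
  have := h.comp_extOf (k := k) hs hA (h.shortExact (k := k) hs hA h.mem_self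
    (exists_triangle X g).choose_spec.choose_spec.choose_spec) e (𝟙 A) (g ≫ e⟦(1 : ℤ)⟧')
    (by simp)
  rw [CategoryTheory.Functor.map_id, Ext.mk₀_id_comp] at this
  exact this.symm

/-- The class of `δ ≫ y[1]` is the pushout along `y` of the resolution with connecting
morphism `δ`. -/
lemma extOf_eq {A X₁ X₀ : C} (hA : reduced d T A) {u : X₁ ⟶ X₀} {c : X₀ ⟶ A}
    {δ : A ⟶ X₁⟦(1 : ℤ)⟧} {hT : Triangle.mk u c δ ∈ distTriang C}
    (hE : (coyonedaComplex X hT).ShortExact) (y : X₁ ⟶ X) :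
    h.extOf k hs hA (δ ≫ y⟦(1 : ℤ)⟧') =
      (triangleClass hE).comp (Ext.mk₀ ((preadditiveCoyonedaObj X).map y)) (add_zero 1) := by
  have := h.comp_extOf (k := k) hs hA hE y (𝟙 A) (δ ≫ y⟦(1 : ℤ)⟧') (by simp)
  rw [CategoryTheory.Functor.map_id, Ext.mk₀_id_comp] at this
  exact this.symm

lemma extOf_add {A : C} (hA : reduced d T A) (g g' : A ⟶ X⟦(1 : ℤ)⟧) :
    h.extOf k hs hA (g + g') = h.extOf k hs hA g + h.extOf k hs hA g' := by
  obtain ⟨X₁, X₀, u, c, δ, hT, hX₁, hX₀, -, -⟩ := h.exists_resolution (k := k) hs hA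
  obtain ⟨-, y, rfl⟩ := h.exists_eq_comp_shift (k := k) hs hA hT hX₀ h.mem_self g
  obtain ⟨-, y', rfl⟩ := h.exists_eq_comp_shift (k := k) hs hA hT hX₀ h.mem_self g'
  have hE := h.shortExact (k := k) hs hA hX₁ hT
  rw [← Preadditive.comp_add, ← Functor.map_add, h.extOf_eq hs hA hE, h.extOf_eq hs hA hE,
    h.extOf_eq hs hA hE, Functor.map_add, Ext.mk₀_add, Ext.comp_add]

omit [HomFinite k C] [HasZeroObject C] [HasShift C ℤ]
  [∀ n : ℤ, (shiftFunctor C n).Additive] [Pretriangulated C] [IsIdempotentComplete C]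
  [IsNoetherianRing (End X)ᵐᵒᵖ] in
lemma coyoneda_map_smul {A B : C} (c : k) (f : A ⟶ B) :
    (preadditiveCoyonedaObj X).map (c • f) = c • (preadditiveCoyonedaObj X).map f := by
  refine ModuleCat.hom_ext (LinearMap.ext fun x => ?_)
  change x ≫ (c • f) = (algebraMap k (End X)ᵐᵒᵖ c).unop ≫ x ≫ f
  change X ⟶ A at x
  change _ = (c • 𝟙 X) ≫ x ≫ f
  simp

lemma extOf_smul [∀ n : ℤ, Functor.Linear k (shiftFunctor C n)] {A : C} (hA : reduced d T A)
    (r : k) (g : A ⟶ X⟦(1 : ℤ)⟧) : h.extOf k hs hA (r • g) = r • h.extOf k hs hA g := by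
  obtain ⟨X₁, X₀, u, c, δ, hT, hX₁, hX₀, -, -⟩ := h.exists_resolution (k := k) hs hA
  obtain ⟨-, y, rfl⟩ := h.exists_eq_comp_shift (k := k) hs hA hT hX₀ h.mem_self g
  have hE := h.shortExact (k := k) hs hA hX₁ hT
  rw [← Linear.comp_smul, ← Functor.map_smul, h.extOf_eq hs hA hE, h.extOf_eq hs hA hE,
    coyoneda_map_smul, Ext.mk₀_smul, Ext.comp_smul]

/-- If the class of `g` is zero, then the morphism `X₁ ⟶ X` that corresponds to `g` by means of the
resolution extends to `X₀` on the level of modules, hence in `C`. -/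
lemma extOf_injective {A : C} (hA : reduced d T A) (g : A ⟶ X⟦(1 : ℤ)⟧)
    (hg : h.extOf k hs hA g = 0) : g = 0 := by
  obtain ⟨X₁, X₀, u, c, δ, hT, hX₁, hX₀, -, -⟩ := h.exists_resolution (k := k) hs hA
  obtain ⟨-, y, rfl⟩ := h.exists_eq_comp_shift (k := k) hs hA hT hX₀ h.mem_self g
  have hE := h.shortExact (k := k) hs hA hX₁ hT
  rw [h.extOf_eq hs hA hE] at hg
  obtain ⟨ψ, hψ⟩ := exists_of_triangleClass_comp_eq_zero hE _ hg
  obtain ⟨y₀, hy₀⟩ := exists_map_eq_of_addClosure (k := k) (A := X) ((h.add_iff _).2 hX₀)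
    (ObjectProperty.homMk ψ)
  have huy : u ≫ y₀ = y := by
    rw [← sub_eq_zero]
    apply eq_zero_of_addClosure (k := k) ((h.add_iff _).2 hX₁)
    rw [Functor.map_sub, sub_eq_zero, Functor.map_comp, hy₀]
    exact (ModuleCat.isFG _).ι.map_injective hψ
  rw [← huy, Functor.map_comp, ← Category.assoc, dist_comp₃₁ hT, zero_comp]

lemma extOf_surjective {A : C} (hA : reduced d T A)
    (ξ : Ext ((preadditiveCoyonedaObj X).obj A) ((preadditiveCoyonedaObj X).obj X) 1) :
    ∃ g, h.extOf k hs hA g = ξ := by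
  obtain ⟨X₁, X₀, u, c, δ, hT, hX₁, hX₀, -, -⟩ := h.exists_resolution (k := k) hs hA
  have hE := h.shortExact (k := k) hs hA hX₁ hT
  obtain ⟨ψ, hψ⟩ := exists_triangleClass_comp_eq hE ((fgModuleCat_projective_iff _).1
    (projective_of_addClosure (k := k) ((h.add_iff _).2 hX₀))) ξ
  obtain ⟨y, hy⟩ := exists_map_eq_of_addClosure (k := k) (A := X) ((h.add_iff _).2 hX₁)
    (ObjectProperty.homMk ψ)
  have hy' : (preadditiveCoyonedaObj X).map y = ψ := congrArg (fun f => f.hom) hy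
  exact ⟨δ ≫ y⟦(1 : ℤ)⟧', by rw [h.extOf_eq hs hA hE, hy', hψ]⟩

end IsTiltingPair

end Extensions

/-! ### The Auslander-Reiten translation and the shift -/

section Translation

open Pretriangulated Abelian

section Shift

variable (k : Type v) [Field k] {C : Type u} [Category.{v} C] [Preadditive C] [Linear k C]
  [HasShift C ℤ] [∀ n : ℤ, (shiftFunctor C n).Additive]
  [∀ n : ℤ, Functor.Linear k (shiftFunctor C n)]

/-- Shifting by `d - 1` identifies `Hom(A, B[1])` with `Hom(A[d-1], B[d])`. -/
def shiftHomEquiv (d : ℤ) (A B : C) :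
    (A ⟶ B⟦(1 : ℤ)⟧) ≃ₗ[k] (A⟦d - 1⟧ ⟶ B⟦d⟧) where
  toFun g := g⟦d - 1⟧' ≫ (shiftFunctorAdd' C 1 (d - 1) d (by ring)).inv.app B
  map_add' g g' := by rw [Functor.map_add, Preadditive.add_comp]
  map_smul' c g := by rw [Functor.map_smul, Linear.smul_comp, RingHom.id_apply]
  invFun g := (shiftFunctor C (d - 1)).preimage
    (g ≫ (shiftFunctorAdd' C 1 (d - 1) d (by ring)).hom.app B)
  left_inv g := (shiftFunctor C (d - 1)).map_injective (by simp)
  right_inv g := by simp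

lemma shiftHomEquiv_precomp (d : ℤ) {A A' B : C} (a : A ⟶ A') (g : A' ⟶ B⟦(1 : ℤ)⟧) :
    shiftHomEquiv k d A B (a ≫ g) = a⟦d - 1⟧' ≫ shiftHomEquiv k d A' B g := by
  simp [shiftHomEquiv]

lemma shiftHomEquiv_postcomp (d : ℤ) {A B B' : C} (g : A ⟶ B⟦(1 : ℤ)⟧) (b : B ⟶ B') :
    shiftHomEquiv k d A B' (g ≫ b⟦(1 : ℤ)⟧') = shiftHomEquiv k d A B g ≫ b⟦d⟧' := by
  have := (shiftFunctorAdd' C 1 (d - 1) d (by ring)).inv.naturality b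
  simp only [Functor.comp_map] at this
  simp [shiftHomEquiv, this]

end Shift

section Regular

variable {C : Type u} [Category.{v} C] [Preadditive C]

/-- `Hom(X, X)` is the regular module over the opposite of the endomorphism ring. -/
def coyonedaSelfIso (X : C) :
    (preadditiveCoyonedaObj X).obj X ≅ ModuleCat.of (End X)ᵐᵒᵖ (End X)ᵐᵒᵖ :=
  LinearEquiv.toModuleIso (R := (End X)ᵐᵒᵖ) (X₁ := (X ⟶ X)) (X₂ := (End X)ᵐᵒᵖ)
    { toFun := fun x => MulOpposite.op x
      invFun := fun x => x.unop
      map_add' := fun _ _ => rfl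
      map_smul' := fun _ _ => rfl
      left_inv := fun _ => rfl
      right_inv := fun _ => rfl }

lemma map_coyonedaSelfIso_hom {X : C} (e : (End X)ᵐᵒᵖ) :
    (preadditiveCoyonedaObj X).map e.unop ≫ (coyonedaSelfIso X).hom =
      (coyonedaSelfIso X).hom ≫ rightMul _ e := rfl

end Regular

variable {k : Type v} [Field k] {C : Type u} [Category.{v} C] [Preadditive C] [Linear k C]
  [HomFinite k C] [HasZeroObject C] [HasShift C ℤ] [∀ n : ℤ, (shiftFunctor C n).Additive]
  [∀ n : ℤ, Functor.Linear k (shiftFunctor C n)] [Pretriangulated C] [IsIdempotentComplete C]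
  {d : ℤ} {T X : C} [IsNoetherianRing (End X)ᵐᵒᵖ]

namespace IsTiltingPair

variable (h : IsTiltingPair d T X) (hs : SubProjective (End X)ᵐᵒᵖ)

/-- `Hom(A, X[1])` is `Ext¹(F A, Λ)`, for `A` without direct summands in `add (X ⊞ T[1])`. -/
def extEquiv {A : C} (hA : reduced d T A) :
    (A ⟶ X⟦(1 : ℤ)⟧) ≃ₗ[k] ExtOne ((preadditiveCoyonedaObj X).obj A) :=
  LinearEquiv.ofBijective
    { toFun := fun g => (h.extOf k hs hA g).comp (Ext.mk₀ (coyonedaSelfIso X).hom) (add_zero 1)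
      map_add' := fun g g' => by rw [extOf_add, Ext.add_comp]
      map_smul' := fun c g => by rw [extOf_smul, Ext.smul_comp, RingHom.id_apply] } <| by
    constructor
    · refine (injective_iff_map_eq_zero _).2 fun g hg => h.extOf_injective (k := k) hs hA g ?_
      have := congrArg (fun x => Ext.comp x (Ext.mk₀ (coyonedaSelfIso X).inv) (add_zero 1)) hg
      simpa using this
    · intro ξ
      obtain ⟨g, hg⟩ := h.extOf_surjective (k := k) hs hA
        (ξ.comp (Ext.mk₀ (coyonedaSelfIso X).inv) (add_zero 1))
      exact ⟨g, by simp [hg]⟩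

lemma extEquiv_apply {A : C} (hA : reduced d T A) (g : A ⟶ X⟦(1 : ℤ)⟧) :
    h.extEquiv (k := k) hs hA g =
      (h.extOf k hs hA g).comp (Ext.mk₀ (coyonedaSelfIso X).hom) (add_zero 1) := rfl

lemma extEquiv_precomp {A A' : C} (hA : reduced d T A) (hA' : reduced d T A') (a : A ⟶ A')
    (g : A' ⟶ X⟦(1 : ℤ)⟧) : h.extEquiv (k := k) hs hA (a ≫ g) =
      (Ext.mk₀ ((preadditiveCoyonedaObj X).map a)).comp (h.extEquiv (k := k) hs hA' g)
        (zero_add 1) := by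
  rw [extEquiv_apply, extEquiv_apply, h.extOf_precomp hs hA hA']
  exact Ext.comp_assoc _ _ _ (zero_add 1) (add_zero 1) (by norm_num)

lemma extEquiv_postcomp {A : C} (hA : reduced d T A) (g : A ⟶ X⟦(1 : ℤ)⟧) (e : (End X)ᵐᵒᵖ) :
    h.extEquiv (k := k) hs hA (g ≫ (shiftFunctor C (1 : ℤ)).map (X := X) (Y := X) e.unop) =
      extRightMul k _ e (h.extEquiv (k := k) hs hA g) := by
  rw [extRightMul_apply, extEquiv_apply, extEquiv_apply, h.extOf_postcomp,
    Ext.comp_assoc_of_third_deg_zero, Ext.comp_assoc_of_third_deg_zero, Ext.mk₀_comp_mk₀,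
    Ext.mk₀_comp_mk₀, map_coyonedaSelfIso_hom]

variable (hCY : IsCalabiYau k C d)

/-- The isomorphism `F(A[d-1]) ≅ D Ext¹(F A, Λ)` of vector spaces that is composed of the
duality between `Hom(X, A[d-1])` and `Hom(A[d-1], X[d])` and of the isomorphisms
`Hom(A[d-1], X[d]) ≅ Hom(A, X[1]) ≅ Ext¹(F A, Λ)`. -/
def translateEquiv {A : C} (hA : reduced d T A) :
    (X ⟶ A⟦d - 1⟧) ≃ₗ[k] Module.Dual k (ExtOne ((preadditiveCoyonedaObj X).obj A)) :=
  cyDuality hCY X (A⟦d - 1⟧) ≪≫ₗ (shiftHomEquiv k d A X).dualMap ≪≫ₗ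
    (h.extEquiv (k := k) hs hA).symm.dualMap

lemma translateEquiv_apply {A : C} (hA : reduced d T A) (x : X ⟶ A⟦d - 1⟧)
    (g : A ⟶ X⟦(1 : ℤ)⟧) : h.translateEquiv hs hCY hA x (h.extEquiv (k := k) hs hA g) =
      cyDuality hCY X (A⟦d - 1⟧) x (shiftHomEquiv k d A X g) := by
  simp [translateEquiv]

/-- `F(A[d-1]) ≅ τ(F A)` as modules. -/
def translateIso {A : C} (hA : reduced d T A) :
    (homFunctor k X).obj (A⟦d - 1⟧) ≅
      (arTranslate k (End X)ᵐᵒᵖ).obj ((homFunctor k X).obj A) :=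
  have := finite_hom_over_end k X (A⟦d - 1⟧)
  LinearEquiv.toFGModuleCatIso
    (R := (End X)ᵐᵒᵖ) (V := (X ⟶ A⟦d - 1⟧))
    (W := DExtOne k ((homFunctor k X).obj A).obj)
    { (h.translateEquiv hs hCY hA).toAddEquiv with
      map_smul' := fun c x => by
        refine LinearMap.ext fun ξ => ?_
        obtain ⟨g, rfl⟩ := (h.extEquiv (k := k) hs hA).surjective ξ
        change X ⟶ A⟦d - 1⟧ at x
        change h.translateEquiv hs hCY hA (c.unop ≫ x) _ =
          h.translateEquiv hs hCY hA x (extRightMul k _ c _)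
        rw [← extEquiv_postcomp, translateEquiv_apply, translateEquiv_apply,
          cyDuality_comp_left, shiftHomEquiv_postcomp] }

lemma translateIso_naturality {A A' : C} (hA : reduced d T A) (hA' : reduced d T A')
    (a : A ⟶ A') :
    (homFunctor k X).map (a⟦d - 1⟧') ≫ (h.translateIso hs hCY hA').hom =
      (h.translateIso hs hCY hA).hom ≫
        (arTranslate k (End X)ᵐᵒᵖ).map ((homFunctor k X).map a) := by
  refine FGModuleCat.hom_ext (LinearMap.ext fun x => LinearMap.ext fun ξ => ?_)
  obtain ⟨g, rfl⟩ := (h.extEquiv (k := k) hs hA').surjective ξ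
  change X ⟶ A⟦d - 1⟧ at x
  change h.translateEquiv hs hCY hA' (x ≫ a⟦d - 1⟧') _ =
    h.translateEquiv hs hCY hA x ((Ext.mk₀ ((preadditiveCoyonedaObj X).map a)).comp _
      (zero_add 1))
  rw [← h.extEquiv_precomp hs hA hA', translateEquiv_apply, translateEquiv_apply,
    cyDuality_comp_right, shiftHomEquiv_precomp]

/-- On the objects without direct summands in `add (X ⊞ T[1])`, the functor `F` takes the shift
by `d - 1` to the Auslander-Reiten translation. -/
def translateNatIso :
    (reduced d T).ι ⋙ shiftFunctor C (d - 1) ⋙ homFunctor k X ≅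
      (reduced d T).ι ⋙ homFunctor k X ⋙ arTranslate k (End X)ᵐᵒᵖ :=
  NatIso.ofComponents (fun A => h.translateIso hs hCY A.property)
    fun {A A'} a => h.translateIso_naturality hs hCY A.property A'.property a.hom

end IsTiltingPair

end Translation

/-! ### The square of equivalences -/

/-- Precomposition with a full and essentially surjective functor reflects isomorphisms of
functors: such a functor is the projection to a quotient, up to an equivalence. -/
lemma nonempty_iso_of_comp {B C D : Type*} [Category B] [Category C] [Category D] (L : B ⥤ C)
    [L.Full] [L.EssSurj] {G G' : C ⥤ D} (e : L ⋙ G ≅ L ⋙ G') : Nonempty (G ≅ G') := by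
  let E := CategoryTheory.Quotient.lift L.homRel L (by simp)
  let e' : E ⋙ G ≅ E ⋙ G' := CategoryTheory.Quotient.natIsoLift L.homRel e
  exact ⟨((Functor.whiskeringLeft _ _ D).obj E).preimageIso e'⟩

section Equivalences

open Pretriangulated Abelian

instance {Λ : Type v} [Ring Λ] [IsNoetherianRing Λ] : HasFiniteBiproducts (FGModuleCat.{v} Λ) :=
  Abelian.hasFiniteBiproducts

variable {k : Type v} [Field k]

instance {Λ : Type v} [Ring Λ] [Algebra k Λ] [Module.Finite k Λ] :
    (arTranslate k Λ).Additive where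
  map_add {M N f g} := by
    refine FGModuleCat.hom_ext (LinearMap.ext fun φ => LinearMap.ext fun x => ?_)
    change φ.form ((Ext.mk₀ (f.hom + g.hom)).comp x (zero_add 1)) =
      φ.form ((Ext.mk₀ f.hom).comp x (zero_add 1)) + φ.form ((Ext.mk₀ g.hom).comp x (zero_add 1))
    rw [Ext.mk₀_add, Ext.add_comp, map_add]

/-- The translate of a projective module vanishes. -/
lemma isZero_arTranslate_obj {Λ : Type v} [Ring Λ] [Algebra k Λ] [Module.Finite k Λ]
    {P : FGModuleCat.{v} Λ} (hP : Module.Projective Λ P) : IsZero ((arTranslate k Λ).obj P) := by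
  have : Projective P.obj := (IsProjective.iff_projective (R := Λ) P.obj).1 hP
  rw [IsZero.iff_id_eq_zero]
  refine FGModuleCat.hom_ext (LinearMap.ext fun φ => LinearMap.ext fun x => ?_)
  change φ.form x = 0
  rw [Ext.eq_zero_of_projective x, map_zero]

variable {C : Type u} [Category.{v} C] [Preadditive C] [Linear k C]
  [HomFinite k C] [HasZeroObject C] [HasShift C ℤ] [∀ n : ℤ, (shiftFunctor C n).Additive]
  [Pretriangulated C] [IsIdempotentComplete C]
  {d : ℤ} {T X : C} [IsNoetherianRing (End X)ᵐᵒᵖ]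

namespace IsTiltingPair

variable (h : IsTiltingPair d T X)

variable (k) in
/-- The functor from `C / [X ⊞ T[1]]` to the stable module category that is induced by `F`. -/
def toStable : IdealQuotient (shiftAdd T (2 - d) 1) ⥤ StableMod (End X)ᵐᵒᵖ :=
  inducedFunctor isAddClosed_projective (homFunctor k X) fun _ hA => h.projective hA

lemma isEquivalence_toStable (hs : SubProjective (End X)ᵐᵒᵖ) :
    (h.toStable k).IsEquivalence :=
  have := h.full (k := k) hs
  isEquivalence_inducedFunctor (isAddClosed_shiftAdd _ _ _) _ _ _ (h.dense hs) fun _ _ f hf =>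
    h.factorsThru_of_map hs (isAddClosed_shiftAdd _ _ _) isAddClosed_projective
      h.shiftAdd_of_projective (h.factorsThru_of_map_eq_zero hs) f hf

variable (hs : SubProjective (End X)ᵐᵒᵖ) (hCY : IsCalabiYau k C d)

/-- The functor from `C / [T[1] ⊞ X[d]]` to the injectively stable module category that is
induced by `F`. -/
def toInjStable : IdealQuotient (shiftAdd T 1 d) ⥤ InjStableMod (End X)ᵐᵒᵖ :=
  inducedFunctor isAddClosed_injective (homFunctor k X) fun _ hA => h.injective hs hCY hA

lemma isEquivalence_toInjStable : (h.toInjStable hs hCY).IsEquivalence :=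
  have := h.full (k := k) hs
  isEquivalence_inducedFunctor (isAddClosed_shiftAdd _ _ _) _ _ _ (h.dense hs) fun _ _ f hf =>
    h.factorsThru_of_map hs (isAddClosed_shiftAdd _ _ _) isAddClosed_injective
      (h.shiftAdd_of_injective hs hCY) (h.factorsThru_injective_of_map_eq_zero hs hCY) f hf

end IsTiltingPair

variable (d T) in
/-- The functor from `C / [X ⊞ T[1]]` to `C / [T[1] ⊞ X[d]]` that is induced by the shift by
`d - 1`. -/
def shiftQuotient : IdealQuotient (shiftAdd T (2 - d) 1) ⥤ IdealQuotient (shiftAdd T 1 d) :=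
  inducedFunctor (isAddClosed_shiftAdd _ _ _) (shiftFunctor C (d - 1)) fun _ hA =>
    shiftAdd_shift (d - 1) (by ring) (by ring) hA

omit [IsIdempotentComplete C] in
lemma isEquivalence_shiftQuotient : (shiftQuotient d T).IsEquivalence := by
  refine isEquivalence_inducedFunctor (isAddClosed_shiftAdd _ _ _) _ _ _
    (fun M => ⟨_, ⟨(shiftFunctor C (d - 1)).objObjPreimageIso M⟩⟩) ?_
  rintro A B f ⟨Z, hZ, a, b, hab⟩
  let e := (shiftFunctorCompIsoId C (1 - d) (d - 1) (by ring)).app Z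
  refine ⟨Z⟦1 - d⟧, shiftAdd_shift (1 - d) (by ring) (by ring) hZ,
    (shiftFunctor C (d - 1)).preimage (a ≫ e.inv), (shiftFunctor C (d - 1)).preimage (e.hom ≫ b),
    (shiftFunctor C (d - 1)).map_injective ?_⟩
  simp [hab]

variable (k X) in
/-- The functor on stable categories that is induced by the Auslander-Reiten translation. -/
def stableTranslate : StableMod (End X)ᵐᵒᵖ ⥤ InjStableMod (End X)ᵐᵒᵖ :=
  inducedFunctor isAddClosed_injective (arTranslate k (End X)ᵐᵒᵖ) fun _ hP =>
    (isZero_arTranslate_obj ((fgModuleCat_projective_iff _).1 hP)).injective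

namespace IsTiltingPair

variable (h : IsTiltingPair d T X) (hs : SubProjective (End X)ᵐᵒᵖ) (hCY : IsCalabiYau k C d)
  [∀ n : ℤ, Functor.Linear k (shiftFunctor C n)]

include k in
omit [∀ (n : ℤ), Functor.Linear k (shiftFunctor C n)] in
/-- Every object becomes isomorphic in `C / [X ⊞ T[1]]` to one without summands in
`add (X ⊞ T[1])`. -/
lemma essSurj_reduced : ((reduced d T).ι ⋙ idealProj (shiftAdd T (2 - d) 1)).EssSurj where
  mem_essImage A := by
    have hadd := isAddClosed_shiftAdd T (2 - d) 1
    obtain ⟨A', i, p, hip, hpi, hA'⟩ := exists_noSummandIn (k := k)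
      (HomFinite.finite_hom (k := k)) hadd A.as
    refine ⟨⟨A', hA'⟩, ⟨⟨(idealProj _).map i, (idealProj _).map p, ?_, ?_⟩⟩⟩
    · exact ((idealProj _).map_comp i p).symm.trans ((congrArg _ hip).trans
        ((idealProj _).map_id A'))
    · refine ((idealProj _).map_comp p i).symm.trans (Eq.trans ?_ ((idealProj _).map_id A.as))
      exact ((hadd.idealProj_map_eq_iff _ _).2 hpi).symm

/-- The isomorphism `F ∘ [d-1] ≅ τ ∘ F` extends from the objects without summands in
`add (X ⊞ T[1])` to the ideal quotient. -/
lemma nonempty_square : Nonempty (shiftQuotient d T ⋙ h.toInjStable hs hCY ≅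
    h.toStable k ⋙ stableTranslate k X) := by
  have := essSurj_reduced (k := k) (d := d) (T := T)
  exact nonempty_iso_of_comp ((reduced d T).ι ⋙ idealProj (shiftAdd T (2 - d) 1))
    (Functor.isoWhiskerRight (h.translateNatIso hs hCY) (idealProj _))

include h hs hCY in
/-- In the square the other three functors are equivalences. -/
lemma isEquivalence_stableTranslate : (stableTranslate k X).IsEquivalence := by
  obtain ⟨e⟩ := h.nonempty_square hs hCY
  have := h.isEquivalence_toStable (k := k) hs
  have := h.isEquivalence_toInjStable hs hCY
  have := isEquivalence_shiftQuotient (d := d) (T := T)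
  have := Functor.isEquivalence_of_iso e
  exact Functor.isEquivalence_of_comp_left (h.toStable k) _

omit [IsIdempotentComplete C] [IsNoetherianRing (End X)ᵐᵒᵖ]
  [∀ n : ℤ, Functor.Linear k (shiftFunctor C n)] in
include h in
/-- The kernel of `F` on objects is `add T[1]`. -/
lemma addClosure_shift_one_iff (A : C) :
    addClosure (T⟦(1 : ℤ)⟧) A ↔ IsZero ((homFunctor k X).obj A) := by
  have := h.two_le
  rw [ClusterHereditary.addClosure_shift_iff, homFunctor_obj_isZero_iff]
  refine ⟨fun hA => h.hom_zero (by lia) (by lia) h.mem_self hA, fun hA => ?_⟩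
  refine h.shiftAdd_of_hom_zero 0 fun j h₁ h₂ f => ?_
  exact eq_zero_of_addClosure (k := k) ((h.add_iff _).2 (shiftAdd_shift_self (by lia) h₂)) f
    ((homFunctor_map_eq_zero_iff f).2 fun x => hA _)

end IsTiltingPair

end Equivalences

end

end ClusterHereditary

theorem proposition4 {k : Type v} [Field k]
    {𝒯 : Type u} [Category.{v} 𝒯] [Preadditive 𝒯] [Linear k 𝒯] [HasZeroObject 𝒯]
    [HasShift 𝒯 ℤ] [∀ n : ℤ, (shiftFunctor 𝒯 n).Additive]
    [∀ n : ℤ, Functor.Linear k (shiftFunctor 𝒯 n)]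
    [Pretriangulated 𝒯] [IsTriangulated 𝒯] [IsIdempotentComplete 𝒯] [HomFinite k 𝒯]
    (d : ℕ) (hd : 2 ≤ d) (hCY : IsCalabiYau k 𝒯 d)
    (T : 𝒯) (hT : IsClusterTilting d T) (X : 𝒯) (hX : X = shiftedSum d T)
    (hH : IsHereditary (End X)) :
    -- the functor induced by `F` on `𝒯 / [X ⊕ T[1]]` and the one on `𝒯 / [T[1] ⊕ X[d]]`
    (∃ (Fproj : IdealQuotient (addClosure (X ⊞ T⟦(1 : ℤ)⟧)) ⥤ StableMod (End X)ᵐᵒᵖ)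
      (Finj : IdealQuotient (addClosure (T⟦(1 : ℤ)⟧ ⊞ X⟦(d : ℤ)⟧)) ⥤ InjStableMod (End X)ᵐᵒᵖ),
      IsInducedBy (homFunctor k X) Fproj ∧ Fproj.IsEquivalence ∧
      IsInducedBy (homFunctor k X) Finj ∧ Finj.IsEquivalence ∧
      -- the square formed with the functors induced by `[d-1]` and by `τ`
      ∃ (Sh : IdealQuotient (addClosure (X ⊞ T⟦(1 : ℤ)⟧)) ⥤
          IdealQuotient (addClosure (T⟦(1 : ℤ)⟧ ⊞ X⟦(d : ℤ)⟧)))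
        (Tau : StableMod (End X)ᵐᵒᵖ ⥤ InjStableMod (End X)ᵐᵒᵖ),
        IsInducedBy (shiftFunctor 𝒯 ((d : ℤ) - 1)) Sh ∧ Sh.IsEquivalence ∧
        IsInducedBy (arTranslate k (End X)ᵐᵒᵖ) Tau ∧ Tau.IsEquivalence ∧
        Nonempty (Sh ⋙ Finj ≅ Fproj ⋙ Tau)) ∧
    -- `F ∘ [d-1] ≅ τ ∘ F` with values in modules, away from `add (X ⊕ T[1])`
    Nonempty ((noSummandIn (addClosure (X ⊞ T⟦(1 : ℤ)⟧))).ι ⋙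
        shiftFunctor 𝒯 ((d : ℤ) - 1) ⋙ homFunctor k X ≅
      (noSummandIn (addClosure (X ⊞ T⟦(1 : ℤ)⟧))).ι ⋙
        homFunctor k X ⋙ arTranslate k (End X)ᵐᵒᵖ) ∧
    -- `ind 𝒯 = ind (mod H) ⊔ ind (add T[1])`, through `F`
    Set.BijOn (mapIsoClasses (homFunctor k X))
      (ind 𝒯 \ indIn (addClosure (T⟦(1 : ℤ)⟧))) (ind (FGModuleCat.{v} (End X)ᵐᵒᵖ)) := by
  have h : IsTiltingPair (d : ℤ) T X :=
    { two_le := by exact_mod_cast hd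
      tilting := hT
      add_iff := fun A => by rw [hX]; exact addClosure_shiftedSum_iff d hd T A }
  have := isNoetherianRing_end (k := k) X
  have hs : IsTiltingPair.SubProjective (End X)ᵐᵒᵖ := fun _ _ f _ hN =>
    projective_of_mono hH.projective_ideal f hN
  have hP : addClosure (X ⊞ T⟦(1 : ℤ)⟧) = shiftAdd T (2 - d) 1 := by
    ext A
    exact addClosure_biprod_iff (by lia) (by lia) h.add_iff (addClosure_shift_iff T 1) A
  have hQ : addClosure (T⟦(1 : ℤ)⟧ ⊞ X⟦(d : ℤ)⟧) = shiftAdd T 1 d := by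
    ext A
    exact addClosure_biprod_iff (by lia) (by lia) (addClosure_shift_iff T 1)
      h.addClosure_shift_iff A
  have := h.full (k := k) hs
  rw [hP, hQ]
  exact ⟨⟨h.toStable k, h.toInjStable hs hCY, isInducedBy_inducedFunctor _ _ _,
      h.isEquivalence_toStable hs, isInducedBy_inducedFunctor _ _ _,
      h.isEquivalence_toInjStable hs hCY, shiftQuotient d T, stableTranslate k X,
      isInducedBy_inducedFunctor _ _ _, isEquivalence_shiftQuotient,
      isInducedBy_inducedFunctor _ _ _, h.isEquivalence_stableTranslate hs hCY,
      h.nonempty_square hs hCY⟩,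
    ⟨h.translateNatIso hs hCY⟩,
    bijOn_mapIsoClasses k _ (h.dense hs) (isAddClosed_addClosure _)
      h.addClosure_shift_one_iff⟩
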